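/- Let $(R,\mathfrak m)$ be a Cohen--Macaulay (Noetherian) local ring of dimension $d\ge 1$ with infinite residue field, and let $I_1, I_2$ be $\mathfrak m$-primary ideals of $R$. An element $x\in I_2$ is called superficial for $I_2$ and $I_1$ if there is $r_0>0$ such that $xR\cap I_1^sI_2^r=xI_1^sI_2^{r-1}$ for all $r\ge r_0$ and all $s\ge 0$; a sequence $x_1,\dots,x_d\in I_2$ is called superficial for $I_2$ and $I_1$ if for each $i$ the image of $x_i$ in $R/(x_1,\dots,x_{i-1})$ is superficial for the images of $I_2$ and $I_1$. Let $x_1,\dots,x_d$ be a superficial sequence for $I_2$ and $I_1$ such that $J=(x_1,\dots,x_d)$ is a minimal reduction of $I_2$, and assume $J\subseteq I_1$. (The inclusion $I_2\subseteq I_1$ is not assumed.) Write $\ell$ for length. For $n\gg 0$ we have $$\ell(R/I_1I_2^n)=\sum_{j=0}^{d}(-1)^j g_j\binom{n+d-j-1}{d-j}$$ with integers $g_0,\dots,g_d$, the Hilbert coefficients of $n\mapsto \ell(R/I_1I_2^n)$. Let $F_0=R$ and $F_n=I_1I_2^{n-1}$ for $n\ge 1$, and let $$G_{I_1}(I_2)=\bigoplus_{n\ge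 0}F_n/F_{n+1}=R/I_1\oplus\bigoplus_{n\ge 1}I_1I_2^{n-1}/I_1I_2^{n}.$$ Put $K=I_1\cap I_2$. Since $KF_n\subseteq F_{n+1}$ for all $n\ge 0$, $G_{I_1}(I_2)$ is a graded module over the Rees algebra $\mathcal R(K)=\bigoplus_{n\ge0}K^nt^n$ (which is the Rees algebra of $I_2$ when $I_2\subseteq I_1$). Let $\operatorname{depth} G_{I_1}(I_2)$ be its depth with respect to the homogeneous maximal ideal $\mathfrak m\oplus\bigoplus_{n\ge1}K^nt^n$, i.e. the supremum of the lengths of the $G_{I_1}(I_2)$-regular sequences in this ideal. $G_{I_1}(I_2)$ is called Cohen--Macaulay if $\operatorname{depth} G_{I_1}(I_2)=\dim G_{I_1}(I_2)$. Then all the lengths below are finite, both sums have only finitely many nonzero terms, and: 1. $\displaystyle g_1\ \ge\ \sum_{n\ge 1}\ell\!\left(\frac{I_1I_2^n+J}{J}\right)-\ell(R/I_1)$, with equality if and only if $G_{I_1}(I_2)$ is Cohen--Macaulay; 2. $\displaystyle g_1\ \le\ \sum_{n\ge 1}\ell\!\left(\frac{I_1I_2^n}{J\,I_1I_2^{n-1}}\right)-\ell(R/I_1)$,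 with equality if and only if $\operatorname{depth} G_{I_1}(I_2)\ge d-1$. -/

import Mathlib

open Filter

/-- `J` is a reduction of `I`: `J ⊆ I` and `J I^n = I^(n+1)` for some `n`. -/
def IsReduction {R : Type*} [CommRing R] (J I : Ideal R) : Prop :=
  J ≤ I ∧ ∃ n : ℕ, J * I ^ n = I ^ (n + 1)

/-- `J` is a minimal reduction of `I`, i.e. minimal under inclusion among the reductions. -/
def IsMinimalReduction {R : Type*} [CommRing R] (J I : Ideal R) : Prop :=
  Minimal (fun J' : Ideal R => IsReduction J' I) J

/-- The element `x ∈ I₂` is superficial for `I₂` and `I₁`. -/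
def IsSuperficial {R : Type*} [CommRing R] (I₂ I₁ : Ideal R) (x : R) : Prop :=
  x ∈ I₂ ∧ ∃ r₀ : ℕ, 0 < r₀ ∧ ∀ r ≥ r₀, ∀ s : ℕ,
    Ideal.span {x} ⊓ I₁ ^ s * I₂ ^ r = Ideal.span {x} * (I₁ ^ s * I₂ ^ (r - 1))

/-- A superficial sequence `x₁, …, x_k ∈ I₂` for `I₂` and `I₁`: for every `i` the image of `x_i` in
`R / (x₁, …, x_{i-1})` is superficial for the images of `I₂` and `I₁`. -/
def IsSuperficialSequence {R : Type*} [CommRing R] (I₂ I₁ : Ideal R) {k : ℕ}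
    (x : Fin k → R) : Prop :=
  ∀ i : Fin k, x i ∈ I₂ ∧
    let π := Ideal.Quotient.mk (Ideal.span (x '' {j | j < i}))
    IsSuperficial (I₂.map π) (I₁.map π) (π (x i))

/-- The subquotient `P / (P ∩ Q)` of a module; it is `P / Q` when `Q ⊆ P`. -/
def Subquotient {A : Type*} [CommRing A] {M : Type*} [AddCommGroup M] [Module A M]
    (P Q : Submodule A M) : Type _ :=
  P ⧸ Q.submoduleOf P

instance Subquotient.instAddCommGroup {A : Type*} [CommRing A] {M : Type*} [AddCommGroup M] [Module A M]
    (P Q : Submodule A M) : AddCommGroup (Subquotient P Q) :=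
  inferInstanceAs (AddCommGroup (P ⧸ Q.submoduleOf P))

instance Subquotient.instModule {A : Type*} [CommRing A] {M : Type*} [AddCommGroup M] [Module A M]
    (P Q : Submodule A M) : Module A (Subquotient P Q) :=
  inferInstanceAs (Module A (P ⧸ Q.submoduleOf P))

/-- The depth of `M` with respect to the ideal `𝔞`: the supremum of the lengths of the `M`-regular
sequences in `𝔞`. -/
noncomputable def idealDepth {A : Type*} [CommRing A] (𝔞 : Ideal A)
    (M : Type*) [AddCommGroup M] [Module A M] : ℕ∞ :=
  ⨆ (rs : List A) (_ : (∀ r ∈ rs, r ∈ 𝔞) ∧ RingTheory.Sequence.IsRegular M rs), (rs.length : ℕ∞)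

/-- `depth M = dim M`, the depth being taken with respect to `𝔞`. This is used for the maximal
ideal of a local ring and for the homogeneous maximal ideal of a graded ring over a local ring. -/
def IsCohenMacaulayWrt {A : Type*} [CommRing A] (𝔞 : Ideal A)
    (M : Type*) [AddCommGroup M] [Module A M] : Prop :=
  ((idealDepth 𝔞 M : ℕ∞) : WithBot ℕ∞) = Module.supportDim A M

/-- The ideal `𝔪 ⊕ I t ⊕ I² t² ⊕ ⋯` of the Rees algebra `R[It]` of an ideal `I` in a
local ring `(R, 𝔪)`. -/
noncomputable def reesMaxIdeal {R : Type*} [CommRing R] [IsLocalRing R] (I : Ideal R) :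
    Ideal (reesAlgebra I) :=
  (IsLocalRing.maximalIdeal R).comap
    (Polynomial.constantCoeff.comp (reesAlgebra I).val.toRingHom)

/-- The filtration `R ⊇ I₁ ⊇ I₁ I₂ ⊇ I₁ I₂² ⊇ ⋯` as an `(I₁ ∩ I₂)`-filtration; it is an
`I₂`-filtration when `I₂ ⊆ I₁`. -/
def mixedFiltration {R : Type*} [CommRing R] (I₁ I₂ : Ideal R) : (I₁ ⊓ I₂).Filtration R where
  N
    | 0 => ⊤
    | n + 1 => I₁ * I₂ ^ n
  mono i := by
    cases i with
    | zero => exact le_top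
    | succ n => exact Ideal.mul_mono_right (Ideal.pow_le_pow_right n.le_succ)
  smul_le i := by
    cases i with
    | zero => simp
    | succ n =>
      change (I₁ ⊓ I₂) * (I₁ * I₂ ^ n) ≤ I₁ * I₂ ^ (n + 1)
      calc (I₁ ⊓ I₂) * (I₁ * I₂ ^ n) ≤ I₂ * (I₁ * I₂ ^ n) := Ideal.mul_mono_left inf_le_right
        _ = I₁ * I₂ ^ (n + 1) := by rw [pow_succ]; ring

/-- The filtration `n ↦ N (n + 1)`. -/
def shiftFiltration {R : Type*} [CommRing R] {I : Ideal R} (F : I.Filtration R) :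
    I.Filtration R where
  N n := F.N (n + 1)
  mono i := F.mono (i + 1)
  smul_le i := F.smul_le (i + 1)

/-- The associated graded module `⨁ₙ N n / N (n + 1)` of an `I`-filtration of `R`, as a module over
the Rees algebra of `I`: the quotient of `⨁ₙ N n tⁿ` by `⨁ₙ N (n + 1) tⁿ`. -/
abbrev assocGraded {R : Type*} [CommRing R] {I : Ideal R} (F : I.Filtration R) : Type _ :=
  Subquotient F.submodule (shiftFiltration F).submodule

/-- `G_{I₁}(I₂) = R/I₁ ⊕ ⨁_{n ≥ 1} I₁ I₂^(n-1) / I₁ I₂^n`. -/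
abbrev mixedGraded {R : Type*} [CommRing R] (I₁ I₂ : Ideal R) : Type _ :=
  assocGraded (mixedFiltration I₁ I₂)

/-- `g j`, `0 ≤ j ≤ d`, are the Hilbert coefficients of the function `n ↦ ℓ(R / I₁ I₂ⁿ)`. -/
def IsMixedHilbertCoeff {R : Type*} [CommRing R] (I₁ I₂ : Ideal R) (d : ℕ) (g : ℕ → ℤ) : Prop :=
  ∀ᶠ n : ℕ in atTop, ∃ h : ℕ, Module.length R (R ⧸ I₁ * I₂ ^ n) = (h : ℕ∞) ∧
    (h : ℤ) = ∑ j ∈ Finset.range (d + 1),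
      (-1) ^ j * g j * ((n + d - j - 1).choose (d - j) : ℤ)

/-! Write F_n for the filtration, J = (x_1,…,x_d), L = (x_1,…,x_{d-1}) and h(n) = ℓ(R/(F_{n+1}+L)).
Modulo its predecessors, each x_i is a nonzerodivisor that acts injectively R/F_n → R/F_{n+1} in
high degrees ("strict from n₀"). Hence passing to R/L takes d-1 differences of the Hilbert
polynomial, which keeps g_0 and g_1. Over R/L, computing ℓ(R/(JF_{n+1}+L)) in two ways gives v_n +
h(n+1) = h(n) + ℓ(R/J) for every n ≥ 0, where v_n = ℓ((F_{n+2}+L)/(JF_{n+1}+L)). Telescoping yields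
the exact formula g_1 = ∑ v_n - ℓ(R/I_1).

The summand of the lower bound arises from v_n by adding J to both ideals, and v_n arises from the
summand of the upper bound by adding L. So both bounds hold term by term
(`firstHilbertCoeff_bounds`). Equality means (F_{n+2}+L) ∩ J ⊆ JF_{n+1}+L, respectively F_{n+2} ∩ L
⊆ JF_{n+1}, for all n. The first condition says that x_d is strict modulo L in all degrees, and
Sally's descent (`IsStrictFrom.descend`) spreads this to every x_i. The second says, by the
Valabrega–Valla argument (`inf_le_initialIdeal_succ_mul_iff`), that x_1,…,x_{d-1} are strict in all
degrees.

Strictness of the first k elements is the same as depth ≥ k (`le_idealDepth_quotientGraded_iff`):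
the exchange lemma `HasWeaklyRegular.quotSMulTop` allows x_i t in place of an arbitrary regular
element, and `IsGradedInjectiveFrom.of_isSMulRegular` upgrades injectivity in high degrees to
injectivity. The Cohen–Macaulay case also needs dim G = d (`supportDim_quotientGraded`). The Rees
algebra is that of K = I_1 ∩ I_2; since J ⊆ K and F_{n+1} = JF_n for large n, the filtration is
K-stable. -/

/-! ### Weakly regular sequences, exchange, and depth. -/

section RegularSequences

open RingTheory.Sequence Pointwise

variable {A : Type*} [CommRing A]

/-- There is a weakly `M`-regular sequence of length `k` in the ideal `𝔞`. -/
def HasWeaklyRegular (𝔞 : Ideal A) (k : ℕ) (M : Type*) [AddCommGroup M] [Module A M] : Prop :=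
  ∃ rs : List A, rs.length = k ∧ (∀ r ∈ rs, r ∈ 𝔞) ∧ IsWeaklyRegular M rs

variable {𝔞 : Ideal A} {M N : Type*} [AddCommGroup M] [Module A M] [AddCommGroup N] [Module A N]

theorem HasWeaklyRegular.zero (𝔞 : Ideal A) (M : Type*) [AddCommGroup M] [Module A M] :
    HasWeaklyRegular 𝔞 0 M :=
  ⟨[], rfl, by simp, IsWeaklyRegular.nil A M⟩

theorem hasWeaklyRegular_succ_iff {k : ℕ} :
    HasWeaklyRegular 𝔞 (k + 1) M ↔
      ∃ r ∈ 𝔞, IsSMulRegular M r ∧ HasWeaklyRegular 𝔞 k (QuotSMulTop r M) := by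
  constructor
  · rintro ⟨rs, hlen, hmem, hreg⟩
    match rs with
    | [] => simp at hlen
    | a :: rs =>
      rw [isWeaklyRegular_cons_iff] at hreg
      exact ⟨a, hmem a (by simp), hreg.1, rs, by simpa using hlen,
        fun r hr => hmem r (by simp [hr]), hreg.2⟩
  · rintro ⟨r, hr, hreg, rs, hlen, hmem, h⟩
    refine ⟨r :: rs, by simp [hlen], ?_, IsWeaklyRegular.cons hreg h⟩
    intro s hs
    rcases List.mem_cons.mp hs with rfl | hs
    exacts [hr, hmem s hs]

theorem HasWeaklyRegular.congr (e : M ≃ₗ[A] N) {k : ℕ} (h : HasWeaklyRegular 𝔞 k M) :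
    HasWeaklyRegular 𝔞 k N := by
  obtain ⟨rs, hlen, hmem, hreg⟩ := h
  exact ⟨rs, hlen, hmem, (e.isWeaklyRegular_congr rs).mp hreg⟩

theorem HasWeaklyRegular.mono {k l : ℕ} (hkl : k ≤ l) (h : HasWeaklyRegular 𝔞 l M) :
    HasWeaklyRegular 𝔞 k M := by
  obtain ⟨rs, hlen, hmem, hreg⟩ := h
  refine ⟨rs.take k, by simp [hlen, hkl], fun r hr => hmem r (List.mem_of_mem_take hr), ?_⟩
  rw [← List.take_append_drop k rs, isWeaklyRegular_append_iff] at hreg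
  exact hreg.1

/-- `(M / P) / x (M / P) = M / (P + xM)`. -/
noncomputable def quotSMulTopQuotientEquiv (P : Submodule A M) (x : A) :
    QuotSMulTop x (M ⧸ P) ≃ₗ[A] M ⧸ (P ⊔ x • (⊤ : Submodule A M)) :=
  (Submodule.quotEquivOfEq _ _ (by
    rw [Submodule.map_pointwise_smul, Submodule.map_top, Submodule.range_mkQ])).trans
    (Submodule.quotientQuotientEquivQuotientSup P (x • (⊤ : Submodule A M)))

noncomputable def quotSMulTopComm (M : Type*) [AddCommGroup M] [Module A M] (x y : A) :
    QuotSMulTop x (QuotSMulTop y M) ≃ₗ[A] QuotSMulTop y (QuotSMulTop x M) :=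
  (quotSMulTopQuotientEquiv _ x).trans
    ((Submodule.quotEquivOfEq _ _ (sup_comm _ _)).trans (quotSMulTopQuotientEquiv _ y).symm)

theorem isSMulRegular_quotSMulTop_iff {x y : A} :
    IsSMulRegular (QuotSMulTop x M) y ↔ ∀ m n : M, y • m = x • n → ∃ l, m = x • l := by
  rw [isSMulRegular_quotient_iff_mem_of_smul_mem]
  simp only [Submodule.mem_smul_pointwise_iff_exists, Submodule.mem_top, true_and]
  constructor
  · intro h m n hmn
    obtain ⟨l, hl⟩ := h m ⟨n, hmn.symm⟩
    exact ⟨l, hl.symm⟩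
  · rintro h m ⟨n, hn⟩
    obtain ⟨l, hl⟩ := h m n hn.symm
    exact ⟨l, hl.symm⟩

/-- If y m = x n, regularity of x modulo y writes n = y l, and cancelling y leaves m = x l. This
half of permuting a regular sequence needs no Nakayama argument. -/
theorem IsSMulRegular.quotSMulTop_swap {x y : A} (hy : IsSMulRegular M y)
    (hx : IsSMulRegular (QuotSMulTop y M) x) : IsSMulRegular (QuotSMulTop x M) y := by
  rw [isSMulRegular_quotSMulTop_iff] at hx ⊢
  intro m n h
  obtain ⟨l, rfl⟩ := hx n m h.symm
  exact ⟨l, hy (by simpa only [smul_comm x y l] using h)⟩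

/-- A homomorphism from A/𝔞 to M is an element of M killed by 𝔞, so the hypothesis says Hom(A/𝔞, M)
= 0. -/
theorem exists_isSMulRegular_of_forall_annihilated [IsNoetherianRing A] [Module.Finite A M]
    (h : ∀ m : M, (∀ a ∈ 𝔞, a • m = 0) → m = 0) : ∃ z ∈ 𝔞, IsSMulRegular M z := by
  have hsub : Subsingleton ((A ⧸ 𝔞) →ₗ[A] M) := by
    refine ⟨fun f g => ?_⟩
    have key : ∀ f : (A ⧸ 𝔞) →ₗ[A] M, f = 0 := by
      intro f
      have h1 : f (Ideal.Quotient.mk 𝔞 1) = 0 := by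
        refine h _ fun a ha => ?_
        rw [← map_smul]
        have : a • (Ideal.Quotient.mk 𝔞 1) = Ideal.Quotient.mk 𝔞 (a * 1) := rfl
        rw [this, mul_one, Ideal.Quotient.eq_zero_iff_mem.mpr ha, map_zero]
      ext
      exact h1
    rw [key f, key g]
  obtain ⟨z, hz, hreg⟩ := IsSMulRegular.subsingleton_linearMap_iff.mp hsub
  rw [Ideal.annihilator_quotient] at hz
  exact ⟨z, hz, hreg⟩

theorem IsSMulRegular.eq_zero_of_forall_annihilated {z : A} (hz : z ∈ 𝔞) (h : IsSMulRegular M z)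
    (m : M) (hm : ∀ a ∈ 𝔞, a • m = 0) : m = 0 :=
  h.right_eq_zero_of_smul (hm z hz)

/-- Two regular elements of `𝔞` have quotients with isomorphic socles. -/
theorem forall_annihilated_of_isSMulRegular {x y z : A} (hy : y ∈ 𝔞) (hz : z ∈ 𝔞)
    (hxM : IsSMulRegular M x) (hyM : IsSMulRegular M y)
    (hzM : IsSMulRegular (QuotSMulTop y M) z) (m : QuotSMulTop x M)
    (hm : ∀ a ∈ 𝔞, a • m = 0) : m = 0 := by
  obtain ⟨u, rfl⟩ := Submodule.mkQ_surjective _ m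
  have hmem : ∀ (x : A) (v : M), v ∈ x • (⊤ : Submodule A M) ↔ ∃ w, v = x • w := by
    intro x v
    simp only [Submodule.mem_smul_pointwise_iff_exists, Submodule.mem_top, true_and, eq_comm]
  have hu : ∀ a ∈ 𝔞, ∃ w, a • u = x • w := by
    intro a ha
    have := hm a ha
    rw [← map_smul, Submodule.mkQ_apply, Submodule.Quotient.mk_eq_zero, hmem] at this
    exact this
  -- The correspondence u ↦ v with y u = x v carries socle elements of M/xM to socle elements of
  -- M/yM; there z kills v, so v vanishes modulo y.
  obtain ⟨v, hv⟩ := hu y hy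
  rw [isSMulRegular_quotSMulTop_iff] at hzM
  obtain ⟨w, hw⟩ := hu z hz
  have hzv : z • v = y • w := by
    apply hxM
    simp only
    rw [smul_comm x z v, ← hv, smul_comm z y u, hw, smul_comm]
  obtain ⟨l, rfl⟩ := hzM v w hzv
  rw [Submodule.mkQ_apply, Submodule.Quotient.mk_eq_zero, hmem]
  exact ⟨l, hyM (by simpa only [smul_comm y x l] using hv)⟩

/-- Exchange: any regular element of 𝔞 can start a weakly regular sequence of the available length.
An element z regular on M, M/yM and M/xM mediates: induction moves the sequence from y to z and then
from z to x. No local hypothesis is used, so it applies to Rees algebras. -/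
theorem HasWeaklyRegular.quotSMulTop [IsNoetherianRing A] {k : ℕ} :
    ∀ {M : Type*} [AddCommGroup M] [Module A M] [Module.Finite A M],
      HasWeaklyRegular 𝔞 (k + 1) M → ∀ x ∈ 𝔞, IsSMulRegular M x →
        HasWeaklyRegular 𝔞 k (QuotSMulTop x M) := by
  induction k with
  | zero => exact fun _ _ _ _ => HasWeaklyRegular.zero _ _
  | succ k ih =>
    intro M _ _ _ h x hx hxM
    obtain ⟨y, hy, hyM, hk⟩ := hasWeaklyRegular_succ_iff.mp h
    obtain ⟨w, hw, hwM, -⟩ := hasWeaklyRegular_succ_iff.mp hk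
    -- The product module makes one z regular on all three modules at once.
    obtain ⟨z, hz, hreg⟩ := exists_isSMulRegular_of_forall_annihilated
      (𝔞 := 𝔞) (M := M × QuotSMulTop y M × QuotSMulTop x M) (by
        rintro ⟨m, n, p⟩ hm
        simp only [Prod.smul_mk, Prod.mk_eq_zero] at hm
        rw [hyM.eq_zero_of_forall_annihilated hy m fun a ha => (hm a ha).1,
          hwM.eq_zero_of_forall_annihilated hw n fun a ha => (hm a ha).2.1,
          forall_annihilated_of_isSMulRegular hy hw hxM hyM hwM p fun a ha => (hm a ha).2.2]
        rfl)
    have hzM : IsSMulRegular M z := fun a b hab => by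
      have := @hreg (a, 0) (b, 0) (by simpa using hab)
      simpa using this
    have hzy : IsSMulRegular (QuotSMulTop y M) z := fun a b hab => by
      have := @hreg (0, a, 0) (0, b, 0) (by simpa using hab)
      simpa using this
    have hzx : IsSMulRegular (QuotSMulTop x M) z := fun a b hab => by
      have := @hreg (0, 0, a) (0, 0, b) (by simpa using hab)
      simpa using this
    have h1 : HasWeaklyRegular 𝔞 (k + 1) (QuotSMulTop z M) :=
      hasWeaklyRegular_succ_iff.mpr ⟨y, hy, hyM.quotSMulTop_swap hzy,
        (ih hk z hz hzy).congr (quotSMulTopComm M z y)⟩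
    exact hasWeaklyRegular_succ_iff.mpr ⟨z, hz, hzx,
      (ih h1 x hx (hxM.quotSMulTop_swap hzx)).congr (quotSMulTopComm M x z)⟩

theorem hasWeaklyRegular_of_le_idealDepth {k : ℕ} (h : (k : ℕ∞) ≤ idealDepth 𝔞 M) :
    HasWeaklyRegular 𝔞 k M := by
  rcases k with _ | k
  · exact HasWeaklyRegular.zero _ _
  have hlt : (k : ℕ∞) < idealDepth 𝔞 M := lt_of_lt_of_le (by exact_mod_cast k.lt_succ_self) h
  rw [idealDepth, lt_iSup_iff] at hlt
  obtain ⟨rs, hrs⟩ := hlt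
  rw [lt_iSup_iff] at hrs
  obtain ⟨⟨hmem, hreg⟩, hlen⟩ := hrs
  have : HasWeaklyRegular 𝔞 rs.length M := ⟨rs, rfl, hmem, hreg.toIsWeaklyRegular⟩
  exact this.mono (by exact_mod_cast hlen)

/-- A proper submodule D containing 𝔞M plays the role of Nakayama: it forces M ≠ (rs)M, so weakly
regular sequences in 𝔞 are regular. -/
theorem le_idealDepth_iff {D : Submodule A M} (hD : D ≠ ⊤) (h : ∀ a ∈ 𝔞, ∀ m : M, a • m ∈ D)
    {k : ℕ} : (k : ℕ∞) ≤ idealDepth 𝔞 M ↔ HasWeaklyRegular 𝔞 k M := by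
  refine ⟨hasWeaklyRegular_of_le_idealDepth, ?_⟩
  rintro ⟨rs, rfl, hmem, hreg⟩
  refine le_iSup₂_of_le rs ⟨hmem, hreg, fun htop => hD ?_⟩ le_rfl
  refine top_le_iff.mp (htop.le.trans ?_)
  rw [Submodule.smul_le]
  intro a ha m _
  refine h a ?_ m
  rw [Ideal.ofList] at ha
  exact (Ideal.span_le.mpr hmem : _ ≤ 𝔞) ha

end RegularSequences

/-! ### Depth is bounded by the dimension of associated primes. -/

section AssociatedPrimes

open Pointwise

variable {R : Type*} [CommRing R] [IsNoetherianRing R] [IsLocalRing R]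

/-- Let U be the submodule killed by p. If U ⊆ rM, regularity of r gives U = rU, hence U = 0 by
Nakayama, a contradiction. So U has nonzero image in M/rM, and every associated prime of that image
contains p and r. -/
theorem exists_associatedPrime_quotSMulTop {M : Type*} [AddCommGroup M] [Module R M]
    [Module.Finite R M] {p : Ideal R} (hp : IsAssociatedPrime p M) {r : R}
    (hr : r ∈ IsLocalRing.maximalIdeal R) (hreg : IsSMulRegular M r) :
    r ∉ p ∧ ∃ q, IsAssociatedPrime q (QuotSMulTop r M) ∧ p ≤ q ∧ r ∈ q := by
  obtain ⟨hprime, m, hm⟩ := (isAssociatedPrime_iff (M := M)).mp hp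
  have hmem : ∀ a, a ∈ p ↔ a • m = 0 := by
    intro a
    rw [hm, Submodule.mem_colon_singleton, Submodule.mem_bot]
  have hm0 : m ≠ 0 := fun h0 => hprime.ne_top
    ((Ideal.eq_top_iff_one p).mpr ((hmem 1).mpr (by simp [h0])))
  refine ⟨fun hrp => hm0 (hreg.right_eq_zero_of_smul ((hmem r).mp hrp)), ?_⟩
  let U : Submodule R M :=
    { carrier := {u | ∀ a ∈ p, a • u = 0}
      add_mem' := fun hu hv a ha => by rw [smul_add, hu a ha, hv a ha, add_zero]
      zero_mem' := fun a _ => smul_zero a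
      smul_mem' := fun c u hu a ha => by rw [smul_comm, hu a ha, smul_zero] }
  have hU : ¬ U ≤ r • (⊤ : Submodule R M) := by
    intro hle
    have hUle : U ≤ (Ideal.span {r}) • U := by
      intro u hu
      obtain ⟨v, -, hv⟩ := (Submodule.mem_smul_pointwise_iff_exists _ _ _).mp (hle hu)
      rw [Submodule.ideal_span_singleton_smul, Submodule.mem_smul_pointwise_iff_exists]
      refine ⟨v, fun a ha => hreg ?_, hv⟩
      simp only [smul_zero]
      rw [smul_comm, hv, hu a ha]
    have := Submodule.eq_bot_of_le_smul_of_le_jacobson_bot (Ideal.span {r}) U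
      (IsNoetherian.noetherian U) hUle (by
        rw [IsLocalRing.jacobson_eq_maximalIdeal _ bot_ne_top]
        simpa [Ideal.span_le] using hr)
    have hmU : m ∈ U := fun a ha => (hmem a).mp ha
    rw [this] at hmU
    exact hm0 (by simpa using hmU)
  let V : Submodule R (QuotSMulTop r M) := U.map (Submodule.mkQ _)
  have hV : Nontrivial V := by
    rw [Submodule.nontrivial_iff_ne_bot]
    intro h0
    refine hU fun u hu => ?_
    have : Submodule.mkQ _ u ∈ V := Submodule.mem_map_of_mem hu
    rw [h0, Submodule.mem_bot, Submodule.mkQ_apply, Submodule.Quotient.mk_eq_zero] at this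
    exact this
  obtain ⟨q, hq⟩ := associatedPrimes.nonempty R V
  have hqV : IsAssociatedPrime q V := hq
  refine ⟨q, hqV.map_of_injective V.subtype V.injective_subtype, ?_, ?_⟩
  all_goals obtain ⟨hqp, v, rfl⟩ := (isAssociatedPrime_iff (M := V)).mp hqV
  · intro a ha
    rw [Submodule.mem_colon_singleton, Submodule.mem_bot]
    obtain ⟨_, u, hu, rfl⟩ := v
    ext
    change a • (Submodule.mkQ _ u) = 0
    rw [← map_smul, hu a ha, map_zero]
  · rw [Submodule.mem_colon_singleton, Submodule.mem_bot]
    ext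
    have := QuotSMulTop.mem_annihilator (R := R) (M := M) r
    exact (Module.mem_annihilator.mp this) _

/-- Dividing by a regular r enlarges p to an associated prime containing r ∉ p, so each step of the
sequence costs one dimension. -/
theorem le_ringKrullDim_quotient_of_isAssociatedPrime {k : ℕ} :
    ∀ {M : Type*} [AddCommGroup M] [Module R M] [Module.Finite R M] {p : Ideal R},
      IsAssociatedPrime p M → HasWeaklyRegular (IsLocalRing.maximalIdeal R) k M →
      (k : WithBot ℕ∞) ≤ ringKrullDim (R ⧸ p) := by
  induction k with
  | zero =>
    intro M _ _ _ p hp _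
    have := hp.isPrime
    have : Nontrivial (R ⧸ p) := Ideal.Quotient.nontrivial_iff.mpr this.ne_top
    simpa using ringKrullDim_nonneg_of_nontrivial
  | succ k ih =>
    intro M _ _ _ p hp h
    obtain ⟨r, hr, hreg, hk⟩ := hasWeaklyRegular_succ_iff.mp h
    obtain ⟨hrp, q, hq, hpq, hrq⟩ := exists_associatedPrime_quotSMulTop hp hr hreg
    have := hp.isPrime
    have hle := ringKrullDim_succ_le_of_surjective (Ideal.Quotient.factor hpq)
      (Ideal.Quotient.factor_surjective hpq) (r := Ideal.Quotient.mk p r)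
      (mem_nonZeroDivisors_of_ne_zero (by rwa [Ne, Ideal.Quotient.eq_zero_iff_mem]))
      (by rwa [Ideal.Quotient.factor_mk, Ideal.Quotient.eq_zero_iff_mem])
    refine le_trans ?_ hle
    push_cast
    gcongr
    exact ih hq hk

end AssociatedPrimes

/-! ### Quotients by ideals primary to the maximal ideal. -/

section PrimaryToMaximal

variable {R : Type*} [CommRing R] [IsLocalRing R]

theorem ringKrullDim_quotient_nonpos {Q : Ideal R}
    (hQ : IsLocalRing.maximalIdeal R ≤ Q.radical) : ringKrullDim (R ⧸ Q) ≤ 0 := by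
  rw [ringKrullDim_quotient]
  have : Subsingleton (PrimeSpectrum.zeroLocus (R := R) Q) := by
    refine ⟨fun p q => ?_⟩
    have key : ∀ p : PrimeSpectrum.zeroLocus (R := R) Q,
        p.1.asIdeal = IsLocalRing.maximalIdeal R := fun p =>
      le_antisymm (IsLocalRing.le_maximalIdeal p.1.isPrime.ne_top)
        (hQ.trans (p.1.isPrime.radical_le_iff.mpr p.2))
    exact Subtype.ext (PrimeSpectrum.ext ((key p).trans (key q).symm))
  exact Order.krullDim_nonpos_of_subsingleton

theorem length_quotient_ne_top [IsNoetherianRing R] {Q : Ideal R}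
    (hQ : IsLocalRing.maximalIdeal R ≤ Q.radical) : Module.length R (R ⧸ Q) ≠ ⊤ := by
  have h0 : Ring.KrullDimLE 0 (R ⧸ Q) := by
    rw [Ring.krullDimLE_iff]
    exact_mod_cast ringKrullDim_quotient_nonpos hQ
  have hart : IsArtinianRing (R ⧸ Q) :=
    isArtinianRing_iff_isNoetherianRing_krullDimLE_zero.mpr ⟨inferInstance, h0⟩
  rw [Module.length_eq_of_surjective (R := R ⧸ Q) (S := R) (M := R ⧸ Q)
    Ideal.Quotient.mk_surjective]
  exact Module.length_ne_top

end PrimaryToMaximal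

/-! ### Systems of parameters are regular sequences. -/

section SystemOfParameters

variable {R : Type*} [CommRing R]

/-- The ideal generated by the first `n` terms of a sequence. -/
def initialIdeal (y : ℕ → R) (n : ℕ) : Ideal R :=
  Ideal.span (y '' Set.Iio n)

theorem initialIdeal_zero (y : ℕ → R) : initialIdeal y 0 = ⊥ := by
  simp [initialIdeal]

theorem initialIdeal_succ (y : ℕ → R) (n : ℕ) :
    initialIdeal y (n + 1) = initialIdeal y n ⊔ Ideal.span {y n} := by
  have h : Set.Iio (n + 1) = Set.Iio n ∪ {n} := by
    ext i
    simp only [Set.mem_Iio, Set.mem_union, Set.mem_singleton_iff]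
    omega
  rw [initialIdeal, h, Set.image_union, Set.image_singleton, Ideal.span_union, initialIdeal]

theorem initialIdeal_mono (y : ℕ → R) : Monotone (initialIdeal y) := fun _ _ h =>
  Ideal.span_mono (Set.image_mono (Set.Iio_subset_Iio h))

theorem mem_initialIdeal (y : ℕ → R) {i n : ℕ} (h : i < n) : y i ∈ initialIdeal y n :=
  Ideal.subset_span ⟨i, h, rfl⟩

variable [IsNoetherianRing R] [IsLocalRing R]

/-- The first i parameters vanish in R/p, so the remaining d - i generate an ideal primary to the
maximal ideal there. -/
theorem ringKrullDim_quotient_le_of_initialIdeal {y : ℕ → R} {d i : ℕ}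
    (hy : ∀ j < d, y j ∈ IsLocalRing.maximalIdeal R)
    (hrad : IsLocalRing.maximalIdeal R ≤ (initialIdeal y d).radical) {p : Ideal R} [p.IsPrime]
    (hp : initialIdeal y i ≤ p) : ringKrullDim (R ⧸ p) ≤ ((d - i : ℕ) : WithBot ℕ∞) := by
  classical
  set s : Finset (R ⧸ p) := (Finset.Ico i d).image (fun j => Ideal.Quotient.mk p (y j)) with hs
  have hpm : p ≤ IsLocalRing.maximalIdeal R :=
    IsLocalRing.le_maximalIdeal (Ideal.IsPrime.ne_top ‹_›)
  have : Nontrivial (R ⧸ p) := Ideal.Quotient.nontrivial_iff.mpr (Ideal.IsPrime.ne_top ‹_›)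
  have : IsLocalRing (R ⧸ p) := IsLocalRing.of_surjective' _ Ideal.Quotient.mk_surjective
  have hsj : (s : Set (R ⧸ p)) ⊆ Ring.jacobson (R ⧸ p) := by
    rw [IsLocalRing.ringJacobson_eq_maximalIdeal]
    intro z hz
    simp only [hs, Finset.coe_image, Finset.coe_Ico, Set.mem_image, Set.mem_Ico] at hz
    obtain ⟨j, hj, rfl⟩ := hz
    rw [SetLike.mem_coe, IsLocalRing.mem_maximalIdeal, mem_nonunits_iff]
    intro hu
    obtain ⟨c, hc⟩ := hu.exists_right_inv
    obtain ⟨c, rfl⟩ := Ideal.Quotient.mk_surjective c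
    rw [← map_mul, ← map_one (Ideal.Quotient.mk p), Ideal.Quotient.eq] at hc
    have h1 : y j * c ∈ IsLocalRing.maximalIdeal R := Ideal.mul_mem_right _ _ (hy j hj.2)
    have : (1 : R) ∈ IsLocalRing.maximalIdeal R := by
      simpa only [sub_sub_cancel] using Ideal.sub_mem _ h1 (hpm hc)
    exact (Ideal.IsPrime.ne_top inferInstance) ((Ideal.eq_top_iff_one _).mpr this)
  refine (ringKrullDim_le_ringKrullDim_quotient_add_card s hsj).trans ?_
  have hcard : (s.card : WithBot ℕ∞) ≤ ((d - i : ℕ) : WithBot ℕ∞) := by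
    have : s.card ≤ d - i := Finset.card_image_le.trans (by simp)
    exact_mod_cast this
  have h0 : ringKrullDim ((R ⧸ p) ⧸ Ideal.span (s : Set (R ⧸ p))) ≤ 0 := by
    refine ringKrullDim_quotient_nonpos ?_
    intro z hz
    obtain ⟨z, rfl⟩ := Ideal.Quotient.mk_surjective z
    have hz' : z ∈ IsLocalRing.maximalIdeal R := by
      rw [IsLocalRing.mem_maximalIdeal, mem_nonunits_iff] at hz ⊢
      exact fun h => hz (h.map _)
    obtain ⟨k, hk⟩ := hrad hz'
    refine ⟨k, ?_⟩
    rw [← map_pow]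
    have hle : (initialIdeal y d).map (Ideal.Quotient.mk p) ≤ Ideal.span (s : Set (R ⧸ p)) := by
      rw [initialIdeal, Ideal.map_span, Ideal.span_le]
      rintro _ ⟨_, ⟨j, hj, rfl⟩, rfl⟩
      by_cases hji : j < i
      · rw [Ideal.Quotient.eq_zero_iff_mem.mpr (hp (mem_initialIdeal y hji))]
        exact zero_mem _
      · refine Ideal.subset_span ?_
        rw [hs, Finset.coe_image]
        exact ⟨j, by simpa using ⟨not_lt.mp hji, hj⟩, rfl⟩
    exact hle (Ideal.mem_map_of_mem _ hk)
  calc _ ≤ (0 : WithBot ℕ∞) + s.card := by gcongr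
    _ ≤ _ := by rw [zero_add]; exact hcard

open Pointwise in
/-- A system of parameters in a ring of maximal depth is a regular sequence. -/
theorem mem_initialIdeal_of_mul_mem {y : ℕ → R} {d : ℕ}
    (hy : ∀ j < d, y j ∈ IsLocalRing.maximalIdeal R)
    (hrad : IsLocalRing.maximalIdeal R ≤ (initialIdeal y d).radical)
    (hdepth : HasWeaklyRegular (IsLocalRing.maximalIdeal R) d R) :
    ∀ i < d, ∀ a, y i * a ∈ initialIdeal y i → a ∈ initialIdeal y i := by
  have key : ∀ i, ∀ k, i + k = d →
      HasWeaklyRegular (IsLocalRing.maximalIdeal R) k (R ⧸ initialIdeal y i) ∧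
      (∀ j < i, ∀ a, y j * a ∈ initialIdeal y j → a ∈ initialIdeal y j) := by
    intro i
    induction i with
    | zero =>
      intro k hk
      obtain rfl : k = d := by omega
      exact ⟨hdepth.congr (Submodule.quotEquivOfEqBot _ (initialIdeal_zero y)).symm, by simp⟩
    | succ i ih =>
      intro k hk
      obtain ⟨h1, h2⟩ := ih (k + 1) (by omega)
      have hreg : IsSMulRegular (R ⧸ initialIdeal y i) (y i) := by
        -- A zero divisor y_i lies in an associated prime p, which then contains y_0,…,y_i. Hence
        -- dim R/p ≤ d - i - 1, while the remaining depth d - i is a lower bound for dim R/p.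
        by_contra hnot
        have hmem : y i ∈ ({r : R | IsSMulRegular (R ⧸ initialIdeal y i) r} : Set R)ᶜ := hnot
        rw [← biUnion_associatedPrimes_eq_compl_regular] at hmem
        simp only [Set.mem_iUnion] at hmem
        obtain ⟨p, hp, hyp⟩ := hmem
        have hpa : IsAssociatedPrime p (R ⧸ initialIdeal y i) := hp
        have hprime := hpa.isPrime
        have hle : initialIdeal y i ≤ p := by
          obtain ⟨-, v, rfl⟩ := (isAssociatedPrime_iff (M := R ⧸ initialIdeal y i)).mp hpa
          intro a ha
          rw [Submodule.mem_colon_singleton, Submodule.mem_bot]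
          obtain ⟨v, rfl⟩ := Ideal.Quotient.mk_surjective v
          exact Ideal.Quotient.eq_zero_iff_mem.mpr (Ideal.mul_mem_right v _ ha)
        have hle' : initialIdeal y (i + 1) ≤ p := by
          rw [initialIdeal_succ, sup_le_iff, Ideal.span_le]
          exact ⟨hle, by simpa using hyp⟩
        have := (le_ringKrullDim_quotient_of_isAssociatedPrime hpa h1).trans
          (ringKrullDim_quotient_le_of_initialIdeal hy hrad hle')
        have h3 : k + 1 ≤ d - (i + 1) := by exact_mod_cast this
        omega
      refine ⟨?_, ?_⟩
      · refine (h1.quotSMulTop (y i) (hy i (by omega)) hreg).congr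
          ((quotSMulTopQuotientEquiv _ _).trans (Submodule.quotEquivOfEq _ _ ?_))
        rw [initialIdeal_succ, ← Submodule.ideal_span_singleton_smul, smul_eq_mul, Ideal.mul_top]
      · intro j hj a ha
        rcases Nat.lt_succ_iff_lt_or_eq.mp hj with hj | rfl
        · exact h2 j hj a ha
        · exact mem_of_isSMulRegular_quotient_of_smul_mem hreg ha
  exact (key d 0 rfl).2

end SystemOfParameters

/-! ### Strict elements: Sally descent and Valabrega–Valla conditions. -/

section StrictFiltrations

variable {R : Type*} [CommRing R]

/-- Multiplication by `x` induces injections `R / (F n + L) → R / (F (n + 1) + L)` for `n ≥ n₀`. -/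
def IsStrictFrom (F : ℕ → Ideal R) (L : Ideal R) (x : R) (n₀ : ℕ) : Prop :=
  ∀ n ≥ n₀, ∀ a, x * a ∈ F (n + 1) ⊔ L → a ∈ F n ⊔ L

theorem mem_sup_span_singleton {L : Ideal R} {x a : R} :
    a ∈ L ⊔ Ideal.span {x} ↔ ∃ l ∈ L, ∃ b, a = l + x * b := by
  rw [Submodule.mem_sup]
  constructor
  · rintro ⟨l, hl, z, hz, rfl⟩
    obtain ⟨b, rfl⟩ := Ideal.mem_span_singleton'.mp hz
    exact ⟨l, hl, b, by ring⟩
  · rintro ⟨l, hl, b, rfl⟩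
    exact ⟨l, hl, x * b, Ideal.mem_span_singleton.mpr ⟨b, rfl⟩, rfl⟩

variable {F : ℕ → Ideal R}

theorem pow_mul_mem_filtration {x : R} (hx : ∀ n, ∀ a ∈ F n, x * a ∈ F (n + 1)) (j : ℕ) {n : ℕ}
    {a : R} (ha : a ∈ F n) : x ^ j * a ∈ F (n + j) := by
  induction j with
  | zero => simpa using ha
  | succ j ih =>
    have := hx _ _ ih
    rwa [← mul_assoc, ← pow_succ'] at this

theorem mul_mem_filtration_sup {L : Ideal R} {x : R} (hx : ∀ n, ∀ a ∈ F n, x * a ∈ F (n + 1))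
    {n : ℕ} {a : R} (ha : a ∈ F n ⊔ L) : x * a ∈ F (n + 1) ⊔ L := by
  obtain ⟨f, hf, l, hl, rfl⟩ := Submodule.mem_sup.mp ha
  rw [mul_add]
  exact Submodule.add_mem_sup (hx _ _ hf) (L.mul_mem_left _ hl)

theorem pow_mul_mem_filtration_sup {L : Ideal R} {x : R}
    (hx : ∀ n, ∀ a ∈ F n, x * a ∈ F (n + 1)) (j : ℕ) {n : ℕ} {a : R} (ha : a ∈ F n ⊔ L) :
    x ^ j * a ∈ F (n + j) ⊔ L := by
  obtain ⟨f, hf, l, hl, rfl⟩ := Submodule.mem_sup.mp ha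
  rw [mul_add]
  exact Submodule.add_mem_sup (pow_mul_mem_filtration hx j hf) (L.mul_mem_left _ hl)

theorem IsStrictFrom.pow {L : Ideal R} {x : R} (h : IsStrictFrom F L x 0) (j : ℕ) {n : ℕ} {a : R}
    (ha : x ^ j * a ∈ F (n + j) ⊔ L) : a ∈ F n ⊔ L := by
  induction j with
  | zero => simpa using ha
  | succ j ih =>
    refine ih (h (n + j) (Nat.zero_le _) _ ?_)
    rwa [← mul_assoc, ← pow_succ']

/-- Descent: strictness of `z` modulo `L + (x)` passes to strictness of `z` and of `x` modulo `L`
when `x` is strict in high degrees. -/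
theorem IsStrictFrom.descend {L : Ideal R} {x z : R} {n₀ : ℕ} (hF : F 0 = ⊤)
    (hx : ∀ n, ∀ a ∈ F n, x * a ∈ F (n + 1)) (hz : ∀ n, ∀ a ∈ F n, z * a ∈ F (n + 1))
    (hxs : IsStrictFrom F L x n₀) (hzs : IsStrictFrom F (L ⊔ Ideal.span {x}) z 0) :
    IsStrictFrom F L z 0 ∧ IsStrictFrom F L x 0 := by
  -- The factor z^j lifts degrees into the range where x is strict. Modulo x, a = l + x b with l in
  -- F(n+1) + L; strictness of x in degree n + j cancels x, and induction on n applies to b.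
  have key : ∀ n, ∀ j ≥ n₀, ∀ a, z ^ j * a ∈ F (n + j) ⊔ L → a ∈ F n ⊔ L := by
    intro n
    induction n with
    | zero => intro j _ a _; simp [hF]
    | succ n ih =>
      intro j hj a ha
      have h1 : a ∈ F (n + 1) ⊔ (L ⊔ Ideal.span {x}) :=
        hzs.pow j ((sup_le_sup le_rfl le_sup_left : _ ≤ F (n + 1 + j) ⊔ (L ⊔ Ideal.span {x})) ha)
      rw [← sup_assoc, mem_sup_span_singleton] at h1
      obtain ⟨l, hl, b, rfl⟩ := h1
      have h2 : x * (z ^ j * b) ∈ F (n + j + 1) ⊔ L := by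
        have := Ideal.sub_mem _ ha (pow_mul_mem_filtration_sup hz j hl)
        rw [show n + j + 1 = n + 1 + j by ring]
        convert this using 1
        ring
      exact add_mem hl (mul_mem_filtration_sup hx (ih j hj b (hxs (n + j) (by omega) _ h2)))
  refine ⟨fun n _ a ha => key n (n₀ + 1) (by omega) a ?_, fun n _ a ha => key n n₀ le_rfl a ?_⟩
  · have := pow_mul_mem_filtration_sup hz n₀ ha
    rw [pow_succ, mul_assoc]
    convert this using 2
    ring_nf
  · refine hxs (n + n₀) (by omega) _ ?_
    have := pow_mul_mem_filtration_sup hz n₀ ha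
    rw [show x * (z ^ n₀ * a) = z ^ n₀ * (x * a) by ring]
    convert this using 2
    ring_nf

variable {y : ℕ → R}

/-- For a = l + y_k b, strictness replaces b by f ∈ F n modulo the smaller ideal; what remains after
removing y_k f lies in that smaller ideal, where induction applies. -/
theorem inf_initialIdeal_le_mul {k : ℕ} (hy : ∀ j < k, ∀ n, ∀ a ∈ F n, y j * a ∈ F (n + 1))
    (hs : ∀ j < k, IsStrictFrom F (initialIdeal y j) (y j) 0) (n : ℕ) :
    F (n + 1) ⊓ initialIdeal y k ≤ initialIdeal y k * F n := by
  induction k with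
  | zero => simp [initialIdeal_zero]
  | succ k ih =>
    rintro a ⟨haF, haL⟩
    rw [SetLike.mem_coe, initialIdeal_succ, mem_sup_span_singleton] at haL
    obtain ⟨l, hl, b, rfl⟩ := haL
    have hb : y k * b ∈ F (n + 1) ⊔ initialIdeal y k := by
      have := Submodule.add_mem_sup haF ((initialIdeal y k).neg_mem hl)
      simpa using this
    obtain ⟨f, hf, l', hl', rfl⟩ := Submodule.mem_sup.mp (hs k (by omega) n (Nat.zero_le _) b hb)
    have hmem : l + y k * l' ∈ F (n + 1) ⊓ initialIdeal y k := by
      refine ⟨?_, add_mem hl (Ideal.mul_mem_left _ _ hl')⟩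
      have := Ideal.sub_mem _ haF (hy k (by omega) n f hf)
      rw [SetLike.mem_coe]
      convert this using 1
      ring
    have h1 := ih (fun j hj => hy j (by omega)) (fun j hj => hs j (by omega)) hmem
    have h2 : y k * f ∈ initialIdeal y (k + 1) * F n :=
      Ideal.mul_mem_mul (mem_initialIdeal y k.lt_succ_self) hf
    have h3 := add_mem (Ideal.mul_mono_left (initialIdeal_mono y k.le_succ) h1) h2
    convert h3 using 1
    ring

theorem mem_initialIdeal_succ_mul {k : ℕ} {I : Ideal R} {a : R} :
    a ∈ initialIdeal y (k + 1) * I ↔ ∃ l ∈ initialIdeal y k * I, ∃ b ∈ I, a = l + y k * b := by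
  rw [initialIdeal_succ, Ideal.sup_mul, Submodule.mem_sup]
  constructor
  · rintro ⟨l, hl, z, hz, rfl⟩
    obtain ⟨b, hb, rfl⟩ := Ideal.mem_span_singleton_mul.mp hz
    exact ⟨l, hl, b, hb, rfl⟩
  · rintro ⟨l, hl, b, hb, rfl⟩
    exact ⟨l, hl, _, Ideal.mem_span_singleton_mul.mpr ⟨b, hb, rfl⟩, rfl⟩

/-- Write the element as l + y_k b. Regularity of y_k puts b into the smaller ideal, one filtration
degree lower, so induction on the degree absorbs y_k b. The larger multiplier on the right of `h`
thus comes for free, which is what makes the upper bound see only the first k elements. -/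
theorem inf_initialIdeal_le_mul_of_succ {k : ℕ} (hF : F 0 = ⊤)
    (hy : ∀ n, ∀ a ∈ F n, y k * a ∈ F (n + 1))
    (hreg : ∀ a, y k * a ∈ initialIdeal y k → a ∈ initialIdeal y k)
    (h : ∀ n, F (n + 1) ⊓ initialIdeal y k ≤ initialIdeal y (k + 1) * F n) (n : ℕ) :
    F (n + 1) ⊓ initialIdeal y k ≤ initialIdeal y k * F n := by
  induction n with
  | zero => rw [hF, Ideal.mul_top]; exact inf_le_right
  | succ n ih =>
    intro a ha
    obtain ⟨l, hl, b, hb, rfl⟩ := mem_initialIdeal_succ_mul.mp (h _ ha)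
    have hbL : b ∈ initialIdeal y k := by
      refine hreg b ?_
      have := Ideal.sub_mem _ ha.2 (Ideal.mul_le_left hl)
      simpa using this
    refine add_mem hl ?_
    have hle : initialIdeal y k * F n ≤
        Submodule.comap (LinearMap.mulLeft R (y k)) (initialIdeal y k * F (n + 1)) := by
      rw [Ideal.mul_le]
      intro r hr f hf
      rw [Submodule.mem_comap, LinearMap.mulLeft_apply, mul_left_comm]
      exact Ideal.mul_mem_mul hr (hy n f hf)
    exact hle (ih ⟨hb, hbL⟩)

/-- The converse Valabrega–Valla direction: the previous lemma passes the intersection condition to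
shorter sequences, and at the last element regularity of y_j cancels it from the resulting
representation. -/
theorem isStrictFrom_of_inf_le_mul {k : ℕ} (hF : F 0 = ⊤)
    (hy : ∀ j < k, ∀ n, ∀ a ∈ F n, y j * a ∈ F (n + 1))
    (hreg : ∀ j < k, ∀ a, y j * a ∈ initialIdeal y j → a ∈ initialIdeal y j)
    (h : ∀ n, F (n + 1) ⊓ initialIdeal y k ≤ initialIdeal y k * F n) :
    ∀ j < k, IsStrictFrom F (initialIdeal y j) (y j) 0 := by
  induction k with
  | zero => simp
  | succ k ih =>
    intro j hj
    rcases Nat.lt_succ_iff_lt_or_eq.mp hj with hj | rfl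
    · refine ih (fun j hj => hy j (by omega)) (fun j hj => hreg j (by omega)) ?_ j hj
      exact inf_initialIdeal_le_mul_of_succ hF (hy k (by omega)) (hreg k (by omega))
        fun n => (inf_le_inf_left _ (initialIdeal_mono y k.le_succ)).trans (h n)
    · intro n _ a ha
      obtain ⟨f, hf, l, hl, hfl⟩ := Submodule.mem_sup.mp ha
      have hmem : f ∈ F (n + 1) ⊓ initialIdeal y (j + 1) := by
        refine ⟨hf, ?_⟩
        rw [show f = y j * a - l by rw [← hfl]; ring]
        exact Ideal.sub_mem _ (Ideal.mul_mem_right _ _ (mem_initialIdeal y j.lt_succ_self))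
          (initialIdeal_mono y j.le_succ hl)
      obtain ⟨l', hl', g, hg, rfl⟩ := mem_initialIdeal_succ_mul.mp (h n hmem)
      have h1 : y j * (a - g) ∈ initialIdeal y j := by
        rw [mul_sub, ← hfl]
        have := add_mem (Ideal.mul_le_left hl') hl
        convert this using 1
        ring
      have := Submodule.add_mem_sup hg (hreg j (by omega) _ h1)
      simpa using this

/-- Strictness along the first `k` terms in terms of intersections with the next larger ideal. -/
theorem inf_le_initialIdeal_succ_mul_iff {k : ℕ} (hF : F 0 = ⊤)
    (hy : ∀ j < k + 1, ∀ n, ∀ a ∈ F n, y j * a ∈ F (n + 1))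
    (hreg : ∀ j < k + 1, ∀ a, y j * a ∈ initialIdeal y j → a ∈ initialIdeal y j) :
    (∀ n, F (n + 2) ⊓ initialIdeal y k ≤ initialIdeal y (k + 1) * F (n + 1)) ↔
      ∀ j < k, IsStrictFrom F (initialIdeal y j) (y j) 0 := by
  constructor
  · intro h
    refine isStrictFrom_of_inf_le_mul hF (fun j hj => hy j (by omega))
      (fun j hj => hreg j (by omega))
      (inf_initialIdeal_le_mul_of_succ hF (hy k (by omega)) (hreg k (by omega)) ?_)
    -- The hypothesis starts at F 2; the missing case F 1 is automatic because F 0 is the whole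
    -- ring.
    rintro (_ | n)
    · rw [hF, Ideal.mul_top]
      exact inf_le_right.trans (initialIdeal_mono y k.le_succ)
    · exact h n
  · intro h n
    exact (inf_initialIdeal_le_mul (fun j hj => hy j (by omega)) h (n + 1)).trans
      (Ideal.mul_mono_left (initialIdeal_mono y k.le_succ))

/-- The one-element Valabrega–Valla criterion in R/L. Strictness in degree 0 is free since F 0 is
the whole ring, so starting at F 2 loses nothing. -/
theorem sup_inf_le_iff_isStrictFrom {L : Ideal R} {x : R} (hF : F 0 = ⊤)
    (hreg : ∀ a, x * a ∈ L → a ∈ L) :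
    (∀ n, (F (n + 2) ⊔ L) ⊓ (L ⊔ Ideal.span {x}) ≤ (L ⊔ Ideal.span {x}) * F (n + 1) ⊔ L) ↔
      IsStrictFrom F L x 0 := by
  constructor
  · rintro h (_ | n) - a ha
    · simp [hF]
    · have h1 := h n ⟨ha, Ideal.mem_sup_right (Ideal.mul_mem_right _ _
        (Ideal.mem_span_singleton_self x))⟩
      rw [Ideal.sup_mul, sup_right_comm,
        sup_eq_right.mpr (Ideal.mul_le_left : L * F (n + 1) ≤ L)] at h1
      obtain ⟨l, hl, z, hz, hlz⟩ := Submodule.mem_sup.mp h1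
      obtain ⟨f, hf, rfl⟩ := Ideal.mem_span_singleton_mul.mp hz
      have : x * (a - f) ∈ L := by
        rw [mul_sub, ← hlz]
        simpa using hl
      have := Submodule.add_mem_sup hf (hreg _ this)
      simpa using this
  · rintro h n a ⟨haF, haJ⟩
    obtain ⟨l, hl, b, rfl⟩ := mem_sup_span_singleton.mp haJ
    have hb : x * b ∈ F (n + 1 + 1) ⊔ L := by
      have := Ideal.sub_mem _ haF (Ideal.mem_sup_right hl)
      simpa using this
    obtain ⟨f, hf, l', hl', rfl⟩ := Submodule.mem_sup.mp (h (n + 1) (Nat.zero_le _) b hb)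
    have h1 : x * f ∈ (L ⊔ Ideal.span {x}) * F (n + 1) :=
      Ideal.mul_mem_mul (Ideal.mem_sup_right (Ideal.mem_span_singleton_self x)) hf
    have := Submodule.add_mem_sup h1 (add_mem hl (L.mul_mem_left x hl'))
    convert this using 1
    ring

/-- Descent is iterated with z = y_k held fixed: each step lowers the ideal modulo which y_k is
strict and yields strictness of y_j as a by-product. -/
theorem forall_isStrictFrom_of_last {k : ℕ} (hF : F 0 = ⊤)
    (hy : ∀ j < k + 1, ∀ n, ∀ a ∈ F n, y j * a ∈ F (n + 1))
    (hs : ∀ j < k + 1, ∃ n₀, IsStrictFrom F (initialIdeal y j) (y j) n₀)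
    (hk : IsStrictFrom F (initialIdeal y k) (y k) 0) :
    ∀ j < k + 1, IsStrictFrom F (initialIdeal y j) (y j) 0 := by
  have key : ∀ i, ∀ j, j + i = k → IsStrictFrom F (initialIdeal y j) (y k) 0 ∧
      IsStrictFrom F (initialIdeal y j) (y j) 0 := by
    intro i
    induction i with
    | zero => rintro j rfl; exact ⟨hk, hk⟩
    | succ i ih =>
      intro j hj
      obtain ⟨n₀, hn₀⟩ := hs j (by omega)
      have := (ih (j + 1) (by omega)).1
      rw [initialIdeal_succ] at this
      exact hn₀.descend hF (hy j (by omega)) (hy k (by omega)) this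
  exact fun j hj => (key (k - j) j (by omega)).2

end StrictFiltrations

/-! ### Associated graded modules over the Rees algebra. -/

section AssociatedGraded

variable {R : Type*} [CommRing R] {I : Ideal R}

/-- The filtration `n ↦ N (n + 1) + L`. -/
def shiftSupFiltration (F : I.Filtration R) (L : Ideal R) : I.Filtration R where
  N n := F.N (n + 1) ⊔ L
  mono i := sup_le_sup_right (F.mono (i + 1)) L
  smul_le i := by
    rw [smul_eq_mul, Ideal.mul_sup]
    exact sup_le_sup (F.smul_le (i + 1)) Ideal.mul_le_right

/-- The type of elements of a submodule over a commutative ring. -/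
def SubmoduleType {A : Type*} [CommRing A] {M : Type*} [AddCommGroup M] [Module A M]
    (P : Submodule A M) : Type _ :=
  P

instance SubmoduleType.instAddCommGroup {A : Type*} [CommRing A] {M : Type*} [AddCommGroup M]
    [Module A M] (P : Submodule A M) : AddCommGroup (SubmoduleType P) :=
  inferInstanceAs (AddCommGroup P)

instance SubmoduleType.instModule {A : Type*} [CommRing A] {M : Type*} [AddCommGroup M]
    [Module A M] (P : Submodule A M) : Module A (SubmoduleType P) :=
  inferInstanceAs (Module A P)

/-- The inclusion of a submodule. -/
def SubmoduleType.subtype {A : Type*} [CommRing A] {M : Type*} [AddCommGroup M] [Module A M]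
    (P : Submodule A M) : SubmoduleType P →ₗ[A] M :=
  P.subtype

theorem SubmoduleType.finite {A : Type*} [CommRing A] {M : Type*} [AddCommGroup M] [Module A M]
    {P : Submodule A M} (h : P.FG) : Module.Finite A (SubmoduleType P) :=
  Module.Finite.iff_fg.mpr h

/-- The quotient of a submodule by the preimage of another one is their subquotient. -/
def SubmoduleType.quotientEquiv {A : Type*} [CommRing A] {M : Type*} [AddCommGroup M] [Module A M]
    (P Q : Submodule A M) :
    (SubmoduleType P ⧸ Q.comap (SubmoduleType.subtype P)) ≃ₗ[A] Subquotient P Q :=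
  LinearEquiv.refl A (P ⧸ Q.submoduleOf P)

/-- The module `⨁ N n tⁿ` of a filtration. -/
abbrev filtrationModule (F : I.Filtration R) : Type _ :=
  SubmoduleType F.submodule

/-- The coefficient at `tⁿ` of an element of `⨁ N n tⁿ`. -/
noncomputable def filtrationCoeff {F : I.Filtration R} (f : filtrationModule F) (n : ℕ) : R :=
  (SubmoduleType.subtype F.submodule f).coeff n

/-- The kernel of the map from `⨁ N n tⁿ` to the associated graded module of the filtration induced
on `R / L`. -/
noncomputable def gradedKernel (F : I.Filtration R) (L : Ideal R) :
    Submodule (reesAlgebra I) (filtrationModule F) :=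
  Submodule.comap (SubmoduleType.subtype F.submodule) (shiftSupFiltration F L).submodule

/-- The associated graded module of the filtration induced by `F` on `R / L`. -/
abbrev quotientGraded (F : I.Filtration R) (L : Ideal R) : Type _ :=
  filtrationModule F ⧸ gradedKernel F L

/-- The element `x t` of the Rees algebra. -/
noncomputable def reesDegreeOne {x : R} (hx : x ∈ I) : reesAlgebra I :=
  ⟨Polynomial.monomial 1 x, reesAlgebra.monomial_mem.mpr (by simpa using hx)⟩

/-- The element `a tⁿ` of `⨁ N n tⁿ`. -/
noncomputable def filtrationSingle (F : I.Filtration R) {n : ℕ} {a : R} (ha : a ∈ F.N n) :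
    filtrationModule F :=
  ⟨PolynomialModule.single R n a, fun i => by
    rw [PolynomialModule.coeff_single, Finsupp.single_apply]
    split_ifs with h
    · exact h ▸ ha
    · exact zero_mem _⟩

variable {F : I.Filtration R} {L : Ideal R}

theorem filtrationCoeff_ext {f g : filtrationModule F}
    (h : ∀ n, filtrationCoeff f n = filtrationCoeff g n) : f = g :=
  Subtype.ext (PolynomialModule.coeff_injective (Finsupp.ext h))

theorem filtrationCoeff_mem (f : filtrationModule F) (n : ℕ) : filtrationCoeff f n ∈ F.N n :=
  f.2 n

theorem filtrationCoeff_zero (n : ℕ) : filtrationCoeff (0 : filtrationModule F) n = 0 :=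
  rfl

theorem filtrationCoeff_add (f g : filtrationModule F) (n : ℕ) :
    filtrationCoeff (f + g) n = filtrationCoeff f n + filtrationCoeff g n := by
  simp [filtrationCoeff]

theorem filtrationCoeff_sum {ι : Type*} (s : Finset ι) (f : ι → filtrationModule F) (n : ℕ) :
    filtrationCoeff (∑ i ∈ s, f i) n = ∑ i ∈ s, filtrationCoeff (f i) n := by
  classical
  induction s using Finset.induction_on with
  | empty => simp [filtrationCoeff_zero]
  | insert i s hi ih => rw [Finset.sum_insert hi, Finset.sum_insert hi, filtrationCoeff_add, ih]

theorem filtrationCoeff_smul (r : reesAlgebra I) (f : filtrationModule F) (n : ℕ) :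
    filtrationCoeff (r • f) n =
      ∑ p ∈ Finset.HasAntidiagonal.antidiagonal n, r.1.coeff p.1 * filtrationCoeff f p.2 :=
  PolynomialModule.smul_apply r.1 f.1 n

theorem filtrationCoeff_single {n : ℕ} {a : R} (ha : a ∈ F.N n) (m : ℕ) :
    filtrationCoeff (filtrationSingle F ha) m = if n = m then a else 0 :=
  Finsupp.single_apply

theorem filtrationCoeff_reesDegreeOne_smul {x : R} (hx : x ∈ I) (f : filtrationModule F) (n : ℕ) :
    filtrationCoeff (reesDegreeOne hx • f) n =
      if 1 ≤ n then x * filtrationCoeff f (n - 1) else 0 :=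
  PolynomialModule.monomial_smul_apply 1 x f.1 n

theorem eq_sum_filtrationSingle (f : filtrationModule F) :
    ∃ s : Finset ℕ, f = ∑ n ∈ s, filtrationSingle F (filtrationCoeff_mem f n) := by
  refine ⟨(SubmoduleType.subtype F.submodule f).coeff.support, filtrationCoeff_ext fun m => ?_⟩
  rw [filtrationCoeff_sum]
  simp only [filtrationCoeff_single]
  rw [Finset.sum_ite_eq']
  split_ifs with h
  · rfl
  · exact Finsupp.notMem_support_iff.mp h

theorem mem_gradedKernel {f : filtrationModule F} :
    f ∈ gradedKernel F L ↔ ∀ n, filtrationCoeff f n ∈ F.N (n + 1) ⊔ L :=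
  Iff.rfl

theorem filtrationSingle_mem_gradedKernel {n : ℕ} {a : R} (ha : a ∈ F.N n) :
    filtrationSingle F ha ∈ gradedKernel F L ↔ a ∈ F.N (n + 1) ⊔ L := by
  rw [mem_gradedKernel]
  constructor
  · intro h
    simpa [filtrationCoeff_single] using h n
  · intro h m
    rw [filtrationCoeff_single]
    split_ifs with hm
    · exact hm ▸ h
    · exact zero_mem _

theorem reesDegreeOne_smul_filtrationSingle {x : R} (hx : x ∈ I) {n : ℕ} {a : R} (ha : a ∈ F.N n) :
    reesDegreeOne hx • filtrationSingle F ha =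
      filtrationSingle F (F.smul_le n (Ideal.mul_mem_mul hx ha) : x * a ∈ F.N (n + 1)) := by
  refine filtrationCoeff_ext fun m => ?_
  rw [filtrationCoeff_reesDegreeOne_smul, filtrationCoeff_single, filtrationCoeff_single]
  rcases m with _ | m <;> simp

theorem reesDegreeOne_smul_mem_gradedKernel {x : R} (hx : x ∈ I) (f : filtrationModule F) :
    reesDegreeOne hx • f ∈ gradedKernel F L ↔ ∀ n, x * filtrationCoeff f n ∈ F.N (n + 2) ⊔ L := by
  rw [mem_gradedKernel]
  constructor
  · intro h n
    simpa [filtrationCoeff_reesDegreeOne_smul] using h (n + 1)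
  · rintro h (_ | n)
    · simp [filtrationCoeff_reesDegreeOne_smul]
    · simpa [filtrationCoeff_reesDegreeOne_smul] using h n

theorem reesDegreeOne_mem_reesMaxIdeal [IsLocalRing R] {x : R} (hx : x ∈ I) :
    reesDegreeOne hx ∈ reesMaxIdeal I := by
  change Polynomial.constantCoeff (Polynomial.monomial 1 x) ∈ IsLocalRing.maximalIdeal R
  rw [Polynomial.constantCoeff_apply, Polynomial.coeff_monomial, if_neg one_ne_zero]
  exact zero_mem _

theorem mem_filtration_mul {x : R} (hx : x ∈ I) (n : ℕ) (a : R) (ha : a ∈ F.N n) :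
    x * a ∈ F.N (n + 1) :=
  F.smul_le n (Ideal.mul_mem_mul hx ha)

/-- An element `x t` of degree one acts injectively in degrees `≥ n₀` of the associated graded
module of the filtration induced on `R / L`. -/
def IsGradedInjectiveFrom (F : ℕ → Ideal R) (L : Ideal R) (x : R) (n₀ : ℕ) : Prop :=
  ∀ n ≥ n₀, ∀ a ∈ F n, x * a ∈ F (n + 2) ⊔ L → a ∈ F (n + 1) ⊔ L

theorem IsStrictFrom.isGradedInjectiveFrom {F : ℕ → Ideal R} {L : Ideal R} {x : R} {n₀ : ℕ}
    (h : IsStrictFrom F L x n₀) : IsGradedInjectiveFrom F L x n₀ :=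
  fun n hn a _ ha => h (n + 1) (by omega) a ha

/-- An arbitrary a climbs the filtration from F 0 = R: as long as m < n, x a lies in F(m+2) + L, and
graded injectivity lifts a from level m to m + 1. -/
theorem IsGradedInjectiveFrom.isStrictFrom {x : R} (h0 : F.N 0 = ⊤)
    (h : IsGradedInjectiveFrom F.N L x 0) : IsStrictFrom F.N L x 0 := by
  intro n _ a ha
  have key : ∀ m ≤ n, a ∈ F.N m ⊔ L := by
    intro m
    induction m with
    | zero => intro _; simp [h0]
    | succ m ih =>
      intro hm
      obtain ⟨f, hf, l, hl, rfl⟩ := Submodule.mem_sup.mp (ih (by omega))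
      refine add_mem (h m (Nat.zero_le _) f hf ?_) (Ideal.mem_sup_right hl)
      rw [mul_add] at ha
      have h1 := Ideal.sub_mem _ ha (Ideal.mem_sup_right (L.mul_mem_left x hl))
      rw [add_sub_cancel_right] at h1
      exact (sup_le_sup_right (F.antitone (by omega)) L : F.N (n + 1) ⊔ L ≤ F.N (m + 2) ⊔ L) h1
  exact key n le_rfl

theorem isSMulRegular_reesDegreeOne_iff {x : R} (hx : x ∈ I) :
    IsSMulRegular (quotientGraded F L) (reesDegreeOne hx) ↔ IsGradedInjectiveFrom F.N L x 0 := by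
  rw [isSMulRegular_quotient_iff_mem_of_smul_mem]
  constructor
  · intro h n _ a ha hxa
    rw [← filtrationSingle_mem_gradedKernel ha]
    refine h _ ?_
    rw [reesDegreeOne_smul_filtrationSingle, filtrationSingle_mem_gradedKernel]
    exact hxa
  · intro h f hf
    rw [reesDegreeOne_smul_mem_gradedKernel] at hf
    exact mem_gradedKernel.mpr fun n => h n (Nat.zero_le _) _ (filtrationCoeff_mem f n) (hf n)

-- In degree n + 1, a coefficient of the left side has the form u + x b with u negligible;
-- strictness replaces b by g ∈ F n modulo L, so the class is x t times that of g. Degree 0 is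
-- settled by x ∈ F 1.
open Pointwise in
theorem gradedKernel_sup_span_singleton {x : R} (hx : x ∈ I) (hx1 : x ∈ F.N 1)
    (h : IsStrictFrom F.N L x 0) :
    gradedKernel F (L ⊔ Ideal.span {x}) =
      gradedKernel F L ⊔
        reesDegreeOne hx • (⊤ : Submodule (reesAlgebra I) (filtrationModule F)) := by
  apply le_antisymm
  · intro f hf
    rw [mem_gradedKernel] at hf
    have key : ∀ n, filtrationSingle F (filtrationCoeff_mem f n) ∈
        gradedKernel F L ⊔
          reesDegreeOne hx • (⊤ : Submodule (reesAlgebra I) (filtrationModule F)) := by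
      rintro (_ | n)
      · refine Submodule.mem_sup_left ((filtrationSingle_mem_gradedKernel _).mpr ?_)
        refine (?_ : F.N 1 ⊔ (L ⊔ Ideal.span {x}) ≤ F.N 1 ⊔ L) (hf 0)
        refine sup_le le_sup_left (sup_le le_sup_right (le_sup_of_le_left ?_))
        rwa [Ideal.span_singleton_le_iff_mem]
      · have hfn := hf (n + 1)
        rw [← sup_assoc] at hfn
        obtain ⟨u, hu, b, hb⟩ := mem_sup_span_singleton.mp hfn
        have hxb : x * b ∈ F.N (n + 1) ⊔ L := by
          have := Ideal.sub_mem (F.N (n + 1) ⊔ L)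
            (Ideal.mem_sup_left (filtrationCoeff_mem f (n + 1)))
            ((sup_le_sup_right (F.mono (n + 1)) L : F.N (n + 1 + 1) ⊔ L ≤ F.N (n + 1) ⊔ L) hu)
          rwa [hb, add_sub_cancel_left] at this
        obtain ⟨g, hg, l, hl, rfl⟩ := Submodule.mem_sup.mp (h n (Nat.zero_le _) b hxb)
        have hxg := mem_filtration_mul hx n g hg
        have hv : filtrationCoeff f (n + 1) - x * g ∈ F.N (n + 1) :=
          sub_mem (filtrationCoeff_mem f (n + 1)) hxg
        have hsplit : filtrationSingle F (filtrationCoeff_mem f (n + 1)) =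
            filtrationSingle F hv + reesDegreeOne hx • filtrationSingle F hg := by
          rw [reesDegreeOne_smul_filtrationSingle]
          refine filtrationCoeff_ext fun m => ?_
          simp only [filtrationCoeff_add, filtrationCoeff_single]
          split_ifs <;> simp
        rw [hsplit]
        refine Submodule.add_mem_sup ((filtrationSingle_mem_gradedKernel _).mpr ?_)
          (Submodule.smul_mem_pointwise_smul _ _ _ Submodule.mem_top)
        rw [hb]
        have := add_mem hu (Ideal.mem_sup_right (L.mul_mem_left x hl) :
          x * l ∈ F.N (n + 1 + 1) ⊔ L)
        convert this using 1
        ring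
    obtain ⟨s, hsum⟩ := eq_sum_filtrationSingle f
    rw [hsum]
    exact Submodule.sum_mem _ fun n _ => key n
  · refine sup_le ?_ ?_
    · intro f hf n
      exact (sup_le_sup_left le_sup_left _ :
        F.N (n + 1) ⊔ L ≤ F.N (n + 1) ⊔ (L ⊔ Ideal.span {x})) (hf n)
    · intro f hf
      obtain ⟨g, -, rfl⟩ := (Submodule.mem_smul_pointwise_iff_exists _ _ _).mp hf
      rw [reesDegreeOne_smul_mem_gradedKernel]
      intro n
      exact Ideal.mem_sup_right (Ideal.mem_sup_right
        (Ideal.mul_mem_right _ _ (Ideal.mem_span_singleton_self x)))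

open Pointwise in
/-- `G(R / L) / (x t) G(R / L) = G(R / (L + (x)))` when `x` is strict. -/
noncomputable def quotSMulTopGradedEquiv {x : R} (hx : x ∈ I) (hx1 : x ∈ F.N 1)
    (h : IsStrictFrom F.N L x 0) :
    QuotSMulTop (reesDegreeOne hx) (quotientGraded F L) ≃ₗ[reesAlgebra I]
      quotientGraded F (L ⊔ Ideal.span {x}) :=
  (quotSMulTopQuotientEquiv _ _).trans
    (Submodule.quotEquivOfEq _ _ (gradedKernel_sup_span_singleton hx hx1 h).symm)

/-- Over a filtration of positive depth, injectivity in high degrees is injectivity. -/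
theorem IsGradedInjectiveFrom.of_isSMulRegular [IsLocalRing R]
    (hI : IsLocalRing.maximalIdeal R ≤ I.radical) {x : R} (hx : x ∈ I) {n₀ : ℕ}
    (h : IsGradedInjectiveFrom F.N L x n₀) {z : reesAlgebra I} (hz : z ∈ reesMaxIdeal I)
    (hreg : IsSMulRegular (quotientGraded F L) z) : IsGradedInjectiveFrom F.N L x 0 := by
  -- A power of z has its constant coefficient in I, so that even this coefficient raises the
  -- filtration and kills the graded module.
  obtain ⟨e, he⟩ := hI (show z.1.coeff 0 ∈ IsLocalRing.maximalIdeal R from hz)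
  have hze : (z ^ e).1.coeff 0 ∈ I := by
    have : (z ^ e).1.coeff 0 = z.1.coeff 0 ^ e := by
      simpa using map_pow Polynomial.constantCoeff z.1 e
    rwa [this]
  rw [← isSMulRegular_reesDegreeOne_iff hx, isSMulRegular_quotient_iff_mem_of_smul_mem]
  have hrege := (isSMulRegular_quotient_iff_mem_of_smul_mem _ _).mp (hreg.pow e)
  -- If x t kills f and the components of f below degree m vanish, then x t also kills z^e f, whose
  -- components vanish below m + 1. Once all degrees below n₀ are cleared the hypothesis applies,
  -- and regularity of z^e returns to f.
  have key : ∀ k, ∀ m, m + k = n₀ → ∀ f : filtrationModule F,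
      reesDegreeOne hx • f ∈ gradedKernel F L →
      (∀ j < m, filtrationCoeff f j ∈ F.N (j + 1) ⊔ L) → f ∈ gradedKernel F L := by
    intro k
    induction k with
    | zero =>
      rintro m rfl f hf hlow n
      rcases lt_or_ge n m with hn | hn
      · exact hlow n hn
      · exact h n hn _ (filtrationCoeff_mem f n)
          ((reesDegreeOne_smul_mem_gradedKernel hx f).mp hf n)
    | succ k ih =>
      intro m hm f hf hlow
      refine hrege f (ih (m + 1) (by omega) _ ?_ ?_)
      · rw [smul_comm]
        exact Submodule.smul_mem _ _ hf
      · intro j hj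
        rw [filtrationCoeff_smul]
        refine Submodule.sum_mem _ fun p hp => ?_
        rw [Finset.HasAntidiagonal.mem_antidiagonal] at hp
        by_cases hpm : p.2 < m
        · rw [← hp]
          have := (shiftSupFiltration F L).pow_smul_le p.1 p.2
            (Ideal.mul_mem_mul ((z ^ e).2 p.1) (hlow p.2 hpm))
          exact this
        · have h1 : p.1 = 0 := by omega
          have h2 : p.2 = j := by omega
          rw [h1, h2]
          exact Ideal.mem_sup_left (mem_filtration_mul hze j _ (filtrationCoeff_mem f j))
  exact fun f hf => key n₀ 0 (by omega) f hf (by simp)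

/-! ### Depth of the graded module through strictness. -/

section Depth

variable [IsLocalRing R] {y : ℕ → R} {d : ℕ}

theorem hasWeaklyRegular_quotientGraded_of_isStrictFrom (hy : ∀ j < d, y j ∈ I)
    (hy1 : ∀ j < d, y j ∈ F.N 1) {k : ℕ} :
    ∀ i, i + k ≤ d → (∀ j, i ≤ j → j < i + k → IsStrictFrom F.N (initialIdeal y j) (y j) 0) →
      HasWeaklyRegular (reesMaxIdeal I) k (quotientGraded F (initialIdeal y i)) := by
  induction k with
  | zero => exact fun _ _ _ => HasWeaklyRegular.zero _ _
  | succ k ih =>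
    intro i hik hs
    have hsi := hs i le_rfl (by omega)
    have hyi := hy i (by omega)
    refine hasWeaklyRegular_succ_iff.mpr ⟨reesDegreeOne hyi, reesDegreeOne_mem_reesMaxIdeal hyi,
      (isSMulRegular_reesDegreeOne_iff hyi).mpr hsi.isGradedInjectiveFrom, ?_⟩
    have := ih (i + 1) (by omega) fun j hj hjk => hs j (by omega) (by omega)
    rw [initialIdeal_succ] at this
    exact this.congr (quotSMulTopGradedEquiv hyi (hy1 i (by omega)) hsi).symm

/-- One regular element suffices to make y_i t regular; exchange then divides by it. The surplus m
is 0 for the depth criterion and 1 for the upper bound on depth. -/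
theorem isStrictFrom_of_hasWeaklyRegular_quotientGraded [IsNoetherianRing R]
    (hI : IsLocalRing.maximalIdeal R ≤ I.radical)
    (hfin : Module.Finite (reesAlgebra I) (filtrationModule F))
    (hy : ∀ j < d, y j ∈ I) (h0 : F.N 0 = ⊤) (hy1 : ∀ j < d, y j ∈ F.N 1)
    (hs : ∀ j < d, ∃ n₀, IsStrictFrom F.N (initialIdeal y j) (y j) n₀) {k : ℕ} :
    ∀ i m, i + k ≤ d →
      HasWeaklyRegular (reesMaxIdeal I) (k + m) (quotientGraded F (initialIdeal y i)) →
      (∀ j, i ≤ j → j < i + k → IsStrictFrom F.N (initialIdeal y j) (y j) 0) ∧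
      HasWeaklyRegular (reesMaxIdeal I) m (quotientGraded F (initialIdeal y (i + k))) := by
  induction k with
  | zero =>
    intro i m _ h
    exact ⟨by omega, by simpa using h⟩
  | succ k ih =>
    intro i m hik h
    obtain ⟨z, hz, hreg, -⟩ := hasWeaklyRegular_succ_iff.mp
      (h.mono (by omega) : HasWeaklyRegular _ 1 _)
    have hyi := hy i (by omega)
    obtain ⟨n₀, hn₀⟩ := hs i (by omega)
    have hinj := hn₀.isGradedInjectiveFrom.of_isSMulRegular hI hyi hz hreg
    have hsi := hinj.isStrictFrom h0
    have h1 : HasWeaklyRegular (reesMaxIdeal I) (k + m + 1)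
        (quotientGraded F (initialIdeal y i)) := by
      convert h using 1
      ring
    have h2 := (h1.quotSMulTop _ (reesDegreeOne_mem_reesMaxIdeal hyi)
      ((isSMulRegular_reesDegreeOne_iff hyi).mpr hinj)).congr
      (quotSMulTopGradedEquiv hyi (hy1 i (by omega)) hsi)
    rw [← initialIdeal_succ] at h2
    obtain ⟨h3, h4⟩ := ih (i + 1) m (by omega) h2
    refine ⟨fun j hj hjk => ?_, ?_⟩
    · rcases eq_or_lt_of_le hj with rfl | hj
      · exact hsi
      · exact h3 j hj (by omega)
    · rwa [show i + 1 + k = i + (k + 1) by ring] at h4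

/-- D is the image of the elements with degree-zero coefficient in 𝔪; it misses the class of 1. -/
theorem exists_ne_top_forall_reesMaxIdeal_smul_mem (h0 : F.N 0 = ⊤) (hne : F.N 1 ⊔ L ≠ ⊤) :
    ∃ D : Submodule (reesAlgebra I) (quotientGraded F L), D ≠ ⊤ ∧
      ∀ r ∈ reesMaxIdeal I, ∀ m : quotientGraded F L, r • m ∈ D := by
  have h1 : (1 : R) ∈ F.N 0 := h0 ▸ Submodule.mem_top
  let D : Submodule (reesAlgebra I) (filtrationModule F) :=
    { carrier := {f | filtrationCoeff f 0 ∈ IsLocalRing.maximalIdeal R}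
      add_mem' := fun {f g} hf hg => by
        change filtrationCoeff (f + g) 0 ∈ IsLocalRing.maximalIdeal R
        rw [filtrationCoeff_add]
        exact add_mem hf hg
      zero_mem' := zero_mem (IsLocalRing.maximalIdeal R)
      smul_mem' := fun r f hf => by
        change filtrationCoeff (r • f) 0 ∈ IsLocalRing.maximalIdeal R
        rw [filtrationCoeff_smul]
        simpa using Ideal.mul_mem_left (IsLocalRing.maximalIdeal R) (r.1.coeff 0) hf }
  refine ⟨Submodule.map (gradedKernel F L).mkQ D, fun htop => ?_, fun r hr m => ?_⟩
  · have hmem : (gradedKernel F L).mkQ (filtrationSingle F h1) ∈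
        Submodule.map (gradedKernel F L).mkQ D := by
      rw [htop]
      exact Submodule.mem_top
    obtain ⟨g, hg, hgq⟩ := hmem
    have hsub : g - filtrationSingle F h1 ∈ D :=
      (fun f hf => IsLocalRing.le_maximalIdeal hne (hf 0) : gradedKernel F L ≤ D)
        _ ((Submodule.Quotient.eq _).mp hgq)
    have hD : filtrationSingle F h1 ∈ D := by
      have := sub_mem hg hsub
      rwa [sub_sub_cancel] at this
    have hone : filtrationCoeff (filtrationSingle F h1) 0 ∈ IsLocalRing.maximalIdeal R := hD
    rw [filtrationCoeff_single, if_pos rfl] at hone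
    exact (Ideal.IsPrime.ne_top inferInstance) ((Ideal.eq_top_iff_one _).mpr hone)
  · obtain ⟨f, rfl⟩ := Submodule.mkQ_surjective _ m
    refine ⟨r • f, ?_, map_smul _ _ _⟩
    change filtrationCoeff (r • f) 0 ∈ IsLocalRing.maximalIdeal R
    rw [filtrationCoeff_smul]
    have hr0 : r.1.coeff 0 ∈ IsLocalRing.maximalIdeal R := hr
    simpa using Ideal.mul_mem_right _ _ hr0

theorem le_idealDepth_quotientGraded_iff [IsNoetherianRing R]
    (hI : IsLocalRing.maximalIdeal R ≤ I.radical)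
    (hfin : Module.Finite (reesAlgebra I) (filtrationModule F))
    (hy : ∀ j < d, y j ∈ I) (h0 : F.N 0 = ⊤) (hy1 : ∀ j < d, y j ∈ F.N 1) (hne : F.N 1 ≠ ⊤)
    (hs : ∀ j < d, ∃ n₀, IsStrictFrom F.N (initialIdeal y j) (y j) n₀) {k : ℕ} (hk : k ≤ d) :
    (k : ℕ∞) ≤ idealDepth (reesMaxIdeal I) (quotientGraded F (initialIdeal y 0)) ↔
      ∀ j < k, IsStrictFrom F.N (initialIdeal y j) (y j) 0 := by
  have hne' : F.N 1 ⊔ initialIdeal y 0 ≠ ⊤ := by rwa [initialIdeal_zero, sup_bot_eq]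
  obtain ⟨D, hD, hD'⟩ := exists_ne_top_forall_reesMaxIdeal_smul_mem h0 hne'
  rw [le_idealDepth_iff hD hD']
  constructor
  · intro h j hj
    have h1 := (isStrictFrom_of_hasWeaklyRegular_quotientGraded hI hfin hy h0 hy1 hs (k := k) 0 0
      (by omega) (by rwa [add_zero])).1
    exact h1 j (Nat.zero_le _) (by omega)
  · intro h
    have h1 := hasWeaklyRegular_quotientGraded_of_isStrictFrom (F := F) hy hy1 (k := k) 0 (by omega)
    exact h1 fun j _ hj => h j (by omega)

theorem idealDepth_quotientGraded_le [IsNoetherianRing R]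
    (hI : IsLocalRing.maximalIdeal R ≤ I.radical)
    (hfin : Module.Finite (reesAlgebra I) (filtrationModule F))
    (hy : ∀ j < d, y j ∈ I) (h0 : F.N 0 = ⊤) (hy1 : ∀ j < d, y j ∈ F.N 1) (hne : F.N 1 ≠ ⊤)
    (hs : ∀ j < d, ∃ n₀, IsStrictFrom F.N (initialIdeal y j) (y j) n₀)
    {n₁ : ℕ} (hn₁ : ∀ n ≥ n₁, F.N n ≤ initialIdeal y d) :
    idealDepth (reesMaxIdeal I) (quotientGraded F (initialIdeal y 0)) ≤ d := by
  by_contra hlt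
  have hd : ((d + 1 : ℕ) : ℕ∞) ≤
      idealDepth (reesMaxIdeal I) (quotientGraded F (initialIdeal y 0)) := by
    push_cast
    exact Order.add_one_le_of_lt (not_le.mp hlt)
  have h1 := (isStrictFrom_of_hasWeaklyRegular_quotientGraded hI hfin hy h0 hy1 hs 0 1
    (k := d) (by omega) (hasWeaklyRegular_of_le_idealDepth hd)).2
  rw [zero_add] at h1
  obtain ⟨z, hz, hreg, -⟩ := hasWeaklyRegular_succ_iff.mp h1
  -- The graded module of R/(y_0,…,y_{d-1}) vanishes in high degrees, so even the element 0 is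
  -- injective there. A further regular element would make 0 injective everywhere, forcing 1 ∈ F 1.
  have hinj : IsGradedInjectiveFrom F.N (initialIdeal y d) 0 n₁ :=
    fun n hn a ha _ => Ideal.mem_sup_right (hn₁ n hn ha)
  have h2 : IsGradedInjectiveFrom F.N (initialIdeal y d) 0 0 :=
    hinj.of_isSMulRegular hI (zero_mem I) hz hreg
  have h3 : (1 : R) ∈ F.N (0 + 1) ⊔ initialIdeal y d :=
    h2 0 le_rfl 1 (h0 ▸ Submodule.mem_top) (by rw [zero_mul]; exact zero_mem _)
  have hle : initialIdeal y d ≤ F.N 1 := by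
    rw [initialIdeal, Ideal.span_le]
    rintro _ ⟨j, hj, rfl⟩
    exact hy1 j hj
  rw [zero_add, sup_eq_left.mpr hle] at h3
  exact hne ((Ideal.eq_top_iff_one _).mpr h3)

end Depth

end AssociatedGraded

/-! ### Integrality and the upper bound for the dimension. -/

section ReesIntegral

variable {R : Type*} [CommRing R]

theorem ringKrullDim_le_of_isIntegral {S B : Type*} [CommRing S] [CommRing B] [Algebra S B]
    [Algebra.IsIntegral S B] : ringKrullDim B ≤ ringKrullDim S := by
  refine Order.krullDim_le_of_strictMono (PrimeSpectrum.comap (algebraMap S B)) fun p q hpq => ?_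
  exact Ideal.IsIntegral.comap_lt_comap (I := p.asIdeal) (J := q.asIdeal) hpq

/-- The determinant trick: if `a N ⊆ J N` for a faithful finitely generated ideal `N`, then `a` is
integral over `J`. -/
theorem exists_monic_coeff_mem_pow_eval_eq_zero [IsNoetherianRing R] {J N : Ideal R}
    (hN : ∀ c, (∀ b ∈ N, c * b = 0) → c = 0) {a : R} (ha : ∀ b ∈ N, a * b ∈ J * N) :
    ∃ p : Polynomial R, p.Monic ∧ (∀ k, p.coeff k ∈ J ^ (p.natDegree - k)) ∧ p.eval a = 0 := by
  have hrange : LinearMap.range (algebraMap R (Module.End R N) a) ≤ J • (⊤ : Submodule R N) := by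
    rintro _ ⟨b, rfl⟩
    have hb : a * b.1 ∈ Submodule.map N.subtype (J • (⊤ : Submodule R N)) := by
      rw [Submodule.map_smul'', Submodule.map_top, Submodule.range_subtype]
      exact ha b.1 b.2
    obtain ⟨c, hc, hcb⟩ := hb
    have : algebraMap R (Module.End R N) a b = c := Subtype.ext hcb.symm
    rwa [this]
  obtain ⟨p, hp, -, hcoeff, hp0⟩ :=
    LinearMap.exists_monic_and_natDegree_eq_and_coeff_mem_pow_and_aeval_eq_zero R _ J hrange
  refine ⟨p, hp, hcoeff, hN _ fun b hb => ?_⟩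
  rw [Polynomial.aeval_algebraMap_apply] at hp0
  have := congrArg Subtype.val (LinearMap.congr_fun hp0 ⟨b, hb⟩)
  simpa using this

-- An integral equation for a with coefficients c_k ∈ J^(N-k), multiplied by t^N, becomes an
-- integral equation for a t over the subring generated by R and J t. It therefore suffices that R
-- and the y_j t map into the image of S.
open Polynomial in
theorem reesAlgebra_isIntegral {I : Ideal R} {S B : Type*} [CommRing S] [CommRing B] [Algebra S B]
    (σ : reesAlgebra I →+* B) (hσ : Function.Surjective σ) {y : ℕ → R} {d : ℕ}
    (hy : ∀ j < d, y j ∈ I)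
    (hR : ∀ r : R, σ (algebraMap R _ r) ∈ Set.range (algebraMap S B))
    (hyS : ∀ j (hj : j < d), σ (reesDegreeOne (hy j hj)) ∈ Set.range (algebraMap S B))
    (hint : ∀ a ∈ I, ∃ p : R[X], p.Monic ∧
      (∀ k, p.coeff k ∈ initialIdeal y d ^ (p.natDegree - k)) ∧ p.eval a = 0) :
    Algebra.IsIntegral S B := by
  let T : Subring R[X] :=
    ((integralClosure S B).toSubring.comap σ).map (reesAlgebra I).val.toRingHom
  have hT : ∀ (f : reesAlgebra I), (f : R[X]) ∈ T ↔ IsIntegral S (σ f) := by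
    intro f
    constructor
    · rintro ⟨g, hg, hgf⟩
      obtain rfl : g = f := Subtype.ext hgf
      exact hg
    · intro hf
      exact ⟨f, hf, rfl⟩
  have hrange : ∀ f, σ f ∈ Set.range (algebraMap S B) → (f : R[X]) ∈ T := by
    rintro f ⟨s, hs⟩
    rw [hT, ← hs]
    exact isIntegral_algebraMap
  have hC : ∀ r : R, C r ∈ T := fun r => hrange _ (hR r)
  have hJ1 : ∀ c ∈ initialIdeal y d, monomial 1 c ∈ T := by
    intro c hc
    induction hc using Submodule.span_induction with
    | mem c hc =>
      obtain ⟨j, hj, rfl⟩ := hc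
      exact hrange _ (hyS j hj)
    | zero => rw [map_zero]; exact zero_mem _
    | add a b _ _ ha hb => rw [map_add]; exact add_mem ha hb
    | smul r c _ hc =>
      rw [smul_eq_mul, ← C_mul_monomial]
      exact mul_mem (hC r) hc
  have hJ : ∀ m, ∀ c ∈ initialIdeal y d ^ m, monomial m c ∈ T := by
    intro m
    induction m with
    | zero => exact fun c _ => hC c
    | succ m ih =>
      intro c hc
      rw [pow_succ'] at hc
      refine Submodule.mul_induction_on hc (fun a ha b hb => ?_) fun a b ha hb => ?_
      · rw [add_comm m 1, ← monomial_mul_monomial]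
        exact mul_mem (hJ1 a ha) (ih b hb)
      · rw [map_add]
        exact add_mem ha hb
  have hI1 : ∀ a ∈ I, monomial 1 a ∈ T := by
    intro a ha
    obtain ⟨p, hp, hcoeff, hpa⟩ := hint a ha
    have hJI : initialIdeal y d ≤ I := by
      rw [initialIdeal, Ideal.span_le]
      rintro _ ⟨j, hj, rfl⟩
      exact hy j hj
    have hmem : ∀ k, monomial (p.natDegree - k) (p.coeff k) ∈ reesAlgebra I := fun k =>
      reesAlgebra.monomial_mem.mpr (Ideal.pow_right_mono hJI _ (hcoeff k))
    -- The coefficients are only integral over S, so the equation is taken over the integral closure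
    -- and transitivity finishes.
    let γ : ℕ → integralClosure S B := fun k =>
      ⟨σ ⟨_, hmem k⟩, (hT ⟨_, hmem k⟩).mp (hJ _ _ (hcoeff k))⟩
    let q : (integralClosure S B)[X] := ∑ k ∈ Finset.range (p.natDegree + 1), monomial k (γ k)
    have hγ : γ p.natDegree = 1 := by
      refine Subtype.ext ?_
      change σ ⟨_, hmem p.natDegree⟩ = 1
      rw [← map_one σ]
      congr 1
      refine Subtype.ext ?_
      change monomial (p.natDegree - p.natDegree) (p.coeff p.natDegree) = 1
      rw [Nat.sub_self, hp.coeff_natDegree]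
      rfl
    have hqmonic : q.Monic := by
      refine monic_of_degree_le p.natDegree ?_ ?_
      · refine (degree_sum_le _ _).trans (Finset.sup_le fun k hk => ?_)
        refine (degree_monomial_le _ _).trans ?_
        exact_mod_cast Nat.lt_succ_iff.mp (Finset.mem_range.mp hk)
      · simp only [q, finsetSum_coeff, coeff_monomial]
        rw [Finset.sum_ite_eq' _ p.natDegree, if_pos (by simp), hγ]
    have hat : monomial 1 a ∈ reesAlgebra I := reesAlgebra.monomial_mem.mpr (by simpa using ha)
    refine (hT ⟨_, hat⟩).mpr (isIntegral_trans (A := integralClosure S B) _ ⟨q, hqmonic, ?_⟩)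
    have heval : eval₂ (algebraMap (integralClosure S B) B) (σ ⟨_, hat⟩) q =
        σ (∑ k ∈ Finset.range (p.natDegree + 1),
          (⟨_, hmem k⟩ : reesAlgebra I) * (⟨_, hat⟩ : reesAlgebra I) ^ k) := by
      simp only [q, eval₂_finsetSum, eval₂_monomial, map_sum, map_mul, map_pow]
      rfl
    rw [heval]
    have hzero : (∑ k ∈ Finset.range (p.natDegree + 1),
        (⟨_, hmem k⟩ : reesAlgebra I) * (⟨_, hat⟩ : reesAlgebra I) ^ k) = 0 := by
      refine Subtype.ext ?_
      have h1 : ∀ k ∈ Finset.range (p.natDegree + 1),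
          monomial (p.natDegree - k) (p.coeff k) * (monomial 1 a : R[X]) ^ k =
            monomial p.natDegree (p.coeff k * a ^ k) := by
        intro k hk
        rw [monomial_pow, monomial_mul_monomial, one_mul,
          Nat.sub_add_cancel (Nat.lt_succ_iff.mp (Finset.mem_range.mp hk))]
      have h2 : (∑ k ∈ Finset.range (p.natDegree + 1),
          monomial (p.natDegree - k) (p.coeff k) * (monomial 1 a : R[X]) ^ k) = 0 := by
        rw [Finset.sum_congr rfl h1, ← map_sum, ← eval_eq_sum_range, hpa, map_zero]
      simpa using h2
    rw [hzero, map_zero]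
  have hTop : ∀ f ∈ Algebra.adjoin R (Submodule.map (monomial 1 : R →ₗ[R] R[X]) I : Set R[X]),
      f ∈ T := by
    intro f hf
    induction hf using Algebra.adjoin_induction with
    | mem f hf =>
      obtain ⟨a, ha, rfl⟩ := hf
      exact hI1 a ha
    | algebraMap r => exact hC r
    | add f g _ _ hf hg => exact add_mem hf hg
    | mul f g _ _ hf hg => exact mul_mem hf hg
  refine ⟨fun b => ?_⟩
  obtain ⟨f, rfl⟩ := hσ b
  exact (hT f).mp (hTop f (by rw [adjoin_monomial_eq_reesAlgebra]; exact f.2))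

/-- B is integral over the image of (R/I)[X_1,…,X_d], where X_j ↦ y_j t, and R/I has dimension at
most 0. -/
theorem ringKrullDim_le_of_reesAlgebra_surjective [IsNoetherianRing R] [IsLocalRing R]
    {I : Ideal R} (hI : IsLocalRing.maximalIdeal R ≤ I.radical) {B : Type*} [CommRing B]
    (σ : reesAlgebra I →+* B) (hσ : Function.Surjective σ) {y : ℕ → R} {d : ℕ}
    (hy : ∀ j < d, y j ∈ I) (hI0 : ∀ c ∈ I, σ (algebraMap R _ c) = 0)
    (hint : ∀ a ∈ I, ∃ p : Polynomial R, p.Monic ∧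
      (∀ k, p.coeff k ∈ initialIdeal y d ^ (p.natDegree - k)) ∧ p.eval a = 0) :
    ringKrullDim B ≤ d := by
  let φ : MvPolynomial (Fin d) (R ⧸ I) →+* B := MvPolynomial.eval₂Hom
    (Ideal.Quotient.lift I (σ.comp (algebraMap R (reesAlgebra I))) hI0)
    fun j => σ (reesDegreeOne (hy j j.2))
  let _ : Algebra (MvPolynomial (Fin d) (R ⧸ I)) B := φ.toAlgebra
  have : Algebra.IsIntegral (MvPolynomial (Fin d) (R ⧸ I)) B := by
    refine reesAlgebra_isIntegral σ hσ hy (fun r => ?_) (fun j hj => ?_) hint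
    · exact ⟨MvPolynomial.C (Ideal.Quotient.mk I r), by
        change φ _ = _
        simp [φ]⟩
    · exact ⟨MvPolynomial.X ⟨j, hj⟩, by
        change φ _ = _
        simp [φ]⟩
  refine (ringKrullDim_le_of_isIntegral (S := MvPolynomial (Fin d) (R ⧸ I))).trans ?_
  rw [MvPolynomial.ringKrullDim_of_isNoetherianRing, Nat.card_eq_fintype_card, Fintype.card_fin]
  calc _ ≤ (0 : WithBot ℕ∞) + d := by
        gcongr
        exact ringKrullDim_quotient_nonpos hI
    _ = d := zero_add _

end ReesIntegral

/-! ### Dimension drops along nonzerodivisors. -/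

section QuotientDimension

variable {A : Type*} [CommRing A]

/-- The dimension of `A / P`. -/
noncomputable def quotientDim (P : Ideal A) : WithBot ℕ∞ :=
  ringKrullDim (A ⧸ P)

theorem quotientDim_succ_le {P Q : Ideal A} (hPQ : P ≤ Q) {t : A} (ht : t ∈ Q)
    (hreg : ∀ r, t * r ∈ P → r ∈ P) : quotientDim Q + 1 ≤ quotientDim P := by
  refine ringKrullDim_succ_le_of_surjective (r := Ideal.Quotient.mk P t) (Ideal.Quotient.factor hPQ)
    (Ideal.Quotient.factor_surjective _) ?_ ?_
  · rw [mem_nonZeroDivisors_iff_right]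
    intro z hz
    obtain ⟨r, rfl⟩ := Ideal.Quotient.mk_surjective z
    rw [← map_mul, Ideal.Quotient.eq_zero_iff_mem, mul_comm] at hz
    exact Ideal.Quotient.eq_zero_iff_mem.mpr (hreg r hz)
  · rwa [Ideal.Quotient.factor_mk, Ideal.Quotient.eq_zero_iff_mem]

theorem one_le_quotientDim {P : Ideal A} {t : A} (hreg : ∀ r, t * r ∈ P → r ∈ P)
    (hne : ∀ g, 1 - t * g ∉ P) : 1 ≤ quotientDim P := by
  have hQ : P ⊔ Ideal.span {t} ≠ ⊤ := by
    intro htop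
    obtain ⟨q, hq, g, hg⟩ := mem_sup_span_singleton.mp ((Ideal.eq_top_iff_one _).mp htop)
    exact hne g (by rwa [hg, add_sub_cancel_right])
  have : Nontrivial (A ⧸ P ⊔ Ideal.span {t}) := Ideal.Quotient.nontrivial_iff.mpr hQ
  refine le_trans ?_ (quotientDim_succ_le (le_sup_left : P ≤ P ⊔ Ideal.span {t})
    (Ideal.mem_sup_right (Ideal.mem_span_singleton_self t)) hreg)
  calc (1 : WithBot ℕ∞) = 0 + 1 := (zero_add _).symm
    _ ≤ _ := by
      gcongr
      exact ringKrullDim_nonneg_of_nontrivial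

variable {M : Type*} [AddCommGroup M] [Module A M] [Module.Finite A M]

theorem quotientDim_le_supportDim {P : Ideal A} (h : ∀ r, (∀ m : M, r • m = 0) → r ∈ P) :
    quotientDim P ≤ Module.supportDim A M := by
  rw [Module.supportDim_eq_ringKrullDim_quotient_annihilator]
  exact ringKrullDim_le_of_surjective
    (Ideal.Quotient.factor fun r hr => h r (Module.mem_annihilator.mp hr))
    (Ideal.Quotient.factor_surjective _)

theorem supportDim_le_of_forall_ringHom {c : WithBot ℕ∞}
    (h : ∀ σ : A →+* A ⧸ Module.annihilator A M, Function.Surjective σ →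
      (∀ r, (∀ m : M, r • m = 0) → σ r = 0) → ringKrullDim (A ⧸ Module.annihilator A M) ≤ c) :
    Module.supportDim A M ≤ c := by
  rw [Module.supportDim_eq_ringKrullDim_quotient_annihilator]
  exact h _ Ideal.Quotient.mk_surjective fun r hr =>
    Ideal.Quotient.eq_zero_iff_mem.mpr (Module.mem_annihilator.mpr hr)

end QuotientDimension

/-! ### Dimension of the graded module. -/

section GradedDimension

variable {R : Type*} [CommRing R] {I : Ideal R} {F : I.Filtration R} {L : Ideal R}

theorem filtrationCoeff_smul_single (r : reesAlgebra I) {n : ℕ} {a : R} (ha : a ∈ F.N n) (m : ℕ) :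
    filtrationCoeff (r • filtrationSingle F ha) m = if n ≤ m then r.1.coeff (m - n) * a else 0 :=
  PolynomialModule.smul_single_apply n r.1 a m

/-- The elements of the Rees algebra annihilating the part of high degree of the associated graded
module of the filtration induced on `R / L`. -/
noncomputable def tailAnnihilator (F : I.Filtration R) (L : Ideal R) : Ideal (reesAlgebra I) where
  carrier := {r | ∃ n₀, ∀ n ≥ n₀, ∀ a (ha : a ∈ F.N n),
    r • filtrationSingle F ha ∈ gradedKernel F L}
  add_mem' := by
    rintro r s ⟨m, hm⟩ ⟨n, hn⟩
    refine ⟨max m n, fun k hk a ha => ?_⟩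
    rw [add_smul]
    exact add_mem (hm k (le_of_max_le_left hk) a ha) (hn k (le_of_max_le_right hk) a ha)
  zero_mem' := ⟨0, fun n _ a ha => by rw [zero_smul]; exact zero_mem _⟩
  smul_mem' := by
    rintro r s ⟨m, hm⟩
    refine ⟨m, fun k hk a ha => ?_⟩
    rw [smul_eq_mul, mul_smul]
    exact Submodule.smul_mem _ r (hm k hk a ha)

theorem gradedKernel_mono {L' : Ideal R} (h : L ≤ L') : gradedKernel F L ≤ gradedKernel F L' :=
  fun _ hf n => (sup_le_sup_left h _ : F.N (n + 1) ⊔ L ≤ F.N (n + 1) ⊔ L') (hf n)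

theorem tailAnnihilator_mono {L' : Ideal R} (h : L ≤ L') :
    tailAnnihilator F L ≤ tailAnnihilator F L' := by
  rintro r ⟨m, hm⟩
  exact ⟨m, fun n hn a ha => gradedKernel_mono h (hm n hn a ha)⟩

theorem mem_tailAnnihilator_of_forall_smul_eq_zero {r : reesAlgebra I}
    (hr : ∀ m : quotientGraded F L, r • m = 0) : r ∈ tailAnnihilator F L := by
  refine ⟨0, fun n _ a ha => ?_⟩
  have := hr ((gradedKernel F L).mkQ (filtrationSingle F ha))
  rwa [← map_smul, Submodule.mkQ_apply, Submodule.Quotient.mk_eq_zero] at this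

theorem reesDegreeOne_mem_tailAnnihilator {x : R} (hx : x ∈ I) (hxL : x ∈ L) :
    reesDegreeOne hx ∈ tailAnnihilator F L := by
  refine ⟨0, fun n _ a ha => ?_⟩
  rw [reesDegreeOne_smul_mem_gradedKernel]
  exact fun m => Ideal.mem_sup_right (Ideal.mul_mem_right _ _ hxL)

/-- The reason for working with tails: x is strict only in high degrees, so x t is a nonzerodivisor
modulo the tail annihilator, though perhaps not modulo the annihilator. -/
theorem mem_tailAnnihilator_of_reesDegreeOne_mul_mem {x : R} (hx : x ∈ I) {n₀ : ℕ}
    (hs : IsStrictFrom F.N L x n₀) {r : reesAlgebra I}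
    (hr : reesDegreeOne hx * r ∈ tailAnnihilator F L) : r ∈ tailAnnihilator F L := by
  obtain ⟨m, hm⟩ := hr
  refine ⟨max m n₀, fun n hn a ha k => ?_⟩
  have h1 := hm n (le_of_max_le_left hn) a ha
  rw [mul_smul, reesDegreeOne_smul_mem_gradedKernel] at h1
  change filtrationCoeff (r • filtrationSingle F ha) k ∈ F.N (k + 1) ⊔ L
  by_cases hk : n ≤ k
  · exact hs (k + 1) (by have := le_of_max_le_right hn; omega) _ (h1 k)
  · rw [filtrationCoeff_smul_single, if_neg hk]
    exact zero_mem _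

theorem quotientDim_tailAnnihilator_sup_span {x : R} (hx : x ∈ I) {n₀ : ℕ}
    (hs : IsStrictFrom F.N L x n₀) :
    quotientDim (tailAnnihilator F (L ⊔ Ideal.span {x})) + 1 ≤
      quotientDim (tailAnnihilator F L) :=
  quotientDim_succ_le (tailAnnihilator_mono le_sup_left)
    (reesDegreeOne_mem_tailAnnihilator hx
      (Ideal.mem_sup_right (Ideal.mem_span_singleton_self x)))
    fun _ => mem_tailAnnihilator_of_reesDegreeOne_mul_mem hx hs

/-- The element x t is not a unit modulo the tail annihilator: 1 - x t g has constant coefficient 1,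
so if it killed the tail, the tail itself would be zero. -/
theorem one_le_quotientDim_tailAnnihilator {x : R} (hx : x ∈ I) {n₀ : ℕ}
    (hs : IsStrictFrom F.N L x n₀) (hne : ∀ n₁, ∃ n ≥ n₁, ¬ F.N n ≤ F.N (n + 1) ⊔ L) :
    1 ≤ quotientDim (tailAnnihilator F L) := by
  refine one_le_quotientDim (fun _ => mem_tailAnnihilator_of_reesDegreeOne_mul_mem hx hs) ?_
  rintro g ⟨m, hm⟩
  obtain ⟨n, hn, hnle⟩ := hne m
  refine hnle fun a ha => ?_
  have h2 : filtrationCoeff ((1 - reesDegreeOne hx * g) • filtrationSingle F ha) n ∈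
    F.N (n + 1) ⊔ L := hm n hn a ha n
  rw [filtrationCoeff_smul_single, if_pos le_rfl, Nat.sub_self] at h2
  have h3 : (1 - reesDegreeOne hx * g).1.coeff 0 = 1 := by
    change ((1 : Polynomial R) - Polynomial.monomial 1 x * g.1).coeff 0 = 1
    rw [Polynomial.coeff_sub, Polynomial.mul_coeff_zero]
    simp
  rwa [h3, one_mul] at h2

variable {y : ℕ → R} {d : ℕ}

theorem le_quotientDim_tailAnnihilator (hy : ∀ j < d + 1, y j ∈ I)
    (hs : ∀ j < d + 1, ∃ n₀, IsStrictFrom F.N (initialIdeal y j) (y j) n₀)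
    (hne : ∀ n₁, ∃ n ≥ n₁, ¬ F.N n ≤ F.N (n + 1) ⊔ initialIdeal y d) :
    ((d + 1 : ℕ) : WithBot ℕ∞) ≤ 
      quotientDim (tailAnnihilator F (initialIdeal y 0)) := by
  have key : ∀ k ≤ d, ((k + 1 : ℕ) : WithBot ℕ∞) ≤
      quotientDim (tailAnnihilator F (initialIdeal y (d - k))) := by
    intro k
    induction k with
    | zero =>
      intro _
      obtain ⟨n₀, hn₀⟩ := hs d (by omega)
      exact_mod_cast one_le_quotientDim_tailAnnihilator (hy d (by omega)) hn₀ hne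
    | succ k ih =>
      intro hk
      obtain ⟨n₀, hn₀⟩ := hs (d - (k + 1)) (by omega)
      have h1 := quotientDim_tailAnnihilator_sup_span (hy (d - (k + 1)) (by omega)) hn₀
      rw [← initialIdeal_succ, show d - (k + 1) + 1 = d - k by omega] at h1
      refine le_trans ?_ h1
      rw [Nat.cast_succ]
      gcongr
      exact ih (by omega)
  have := key d le_rfl
  rwa [Nat.sub_self] at this

/-- Integrality over a polynomial ring in d + 1 variables bounds the dimension above; the tail
annihilators modulo successive initial ideals, each step worth one dimension, bound it below. -/
theorem supportDim_quotientGraded [IsNoetherianRing R] [IsLocalRing R]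
    (hI : IsLocalRing.maximalIdeal R ≤ I.radical)
    (hfin : Module.Finite (reesAlgebra I) (filtrationModule F)) (hy : ∀ j < d + 1, y j ∈ I)
    (hs : ∀ j < d + 1, ∃ n₀, IsStrictFrom F.N (initialIdeal y j) (y j) n₀)
    (hne : ∀ n₁, ∃ n ≥ n₁, ¬ F.N n ≤ F.N (n + 1) ⊔ initialIdeal y d)
    (hint : ∀ a ∈ I, ∃ p : Polynomial R, p.Monic ∧
      (∀ k, p.coeff k ∈ initialIdeal y (d + 1) ^ (p.natDegree - k)) ∧ p.eval a = 0) :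
    Module.supportDim (reesAlgebra I) (quotientGraded F (initialIdeal y 0)) = (d + 1 : ℕ) := by
  apply le_antisymm
  · refine supportDim_le_of_forall_ringHom fun σ hσ hσ0 =>
      ringKrullDim_le_of_reesAlgebra_surjective hI σ hσ hy (fun c hc => hσ0 _ ?_) hint
    intro m
    obtain ⟨f, rfl⟩ := Submodule.mkQ_surjective _ m
    rw [← map_smul, Submodule.mkQ_apply, Submodule.Quotient.mk_eq_zero, mem_gradedKernel]
    intro n
    rw [filtrationCoeff_smul]
    refine Submodule.sum_mem _ fun p hp => ?_
    have hcoeff : (algebraMap R (reesAlgebra I) c).1.coeff p.1 = if p.1 = 0 then c else 0 :=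
      Polynomial.coeff_C
    rw [hcoeff]
    rw [Finset.HasAntidiagonal.mem_antidiagonal] at hp
    split_ifs with h0
    · obtain rfl : p.2 = n := by omega
      exact Ideal.mem_sup_left (mem_filtration_mul hc _ _ (filtrationCoeff_mem f _))
    · rw [zero_mul]
      exact zero_mem _
  · exact (le_quotientDim_tailAnnihilator hy hs hne).trans
      (quotientDim_le_supportDim fun _ => mem_tailAnnihilator_of_forall_smul_eq_zero)

end GradedDimension

/-! ### Exact sequences and lengths. -/

section Lengths

variable {R : Type*} [CommRing R]

/-- The hypothesis is (Q' : x) = Q, giving the exact sequence 0 → R/Q → R/Q' → R/(Q' + (x)) → 0. -/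
theorem length_quotient_eq_add_of_colon {Q Q' : Ideal R} {x : R} (h : ∀ a, x * a ∈ Q' ↔ a ∈ Q) :
    Module.length R (R ⧸ Q') =
      Module.length R (R ⧸ Q) + Module.length R (R ⧸ (Q' ⊔ Ideal.span {x})) := by
  have hle : Q ≤ Submodule.comap (LinearMap.mulLeft R x) Q' := fun a ha => (h a).mpr ha
  refine Module.length_eq_add_of_exact (Submodule.mapQ Q Q' (LinearMap.mulLeft R x) hle)
    (Submodule.factor (le_sup_left : Q' ≤ Q' ⊔ Ideal.span {x})) ?_
    (Submodule.factor_surjective _) ?_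
  · rw [← LinearMap.ker_eq_bot, LinearMap.ker_eq_bot']
    intro z hz
    obtain ⟨a, rfl⟩ := Submodule.mkQ_surjective _ z
    rw [Submodule.mkQ_apply, Submodule.mapQ_apply, Submodule.Quotient.mk_eq_zero] at hz
    rw [Submodule.mkQ_apply, Submodule.Quotient.mk_eq_zero]
    exact (h a).mp hz
  · intro z
    obtain ⟨b, rfl⟩ := Submodule.mkQ_surjective _ z
    rw [Submodule.factor_mk, Submodule.mkQ_apply, Submodule.mkQ_apply,
      Submodule.Quotient.mk_eq_zero]
    constructor
    · intro hb
      obtain ⟨q, hq, a, rfl⟩ := mem_sup_span_singleton.mp hb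
      refine ⟨Submodule.Quotient.mk a, ?_⟩
      rw [Submodule.mapQ_apply, Submodule.Quotient.eq]
      simpa using Q'.neg_mem hq
    · rintro ⟨w, hw⟩
      obtain ⟨a, rfl⟩ := Submodule.mkQ_surjective _ w
      rw [Submodule.mkQ_apply, Submodule.mapQ_apply, Submodule.Quotient.eq] at hw
      refine mem_sup_span_singleton.mpr ⟨b - x * a, ?_, a, by ring⟩
      simpa using Q'.neg_mem hw

theorem length_subquotient_add (P Q : Ideal R) :
    Module.length R (R ⧸ Q) =
      Module.length R (Subquotient P Q) + Module.length R (R ⧸ (P ⊔ Q)) := by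
  let f : Subquotient P Q →ₗ[R] R ⧸ Q :=
    Submodule.mapQ (Q.submoduleOf P) Q P.subtype fun a ha => ha
  have hf : ∀ (p : R) (hp : p ∈ P),
      f (Submodule.Quotient.mk (p := Q.submoduleOf P) ⟨p, hp⟩) = Submodule.Quotient.mk p :=
    fun _ _ => rfl
  refine Module.length_eq_add_of_exact f
    (Submodule.factor (le_sup_right : Q ≤ P ⊔ Q)) ?_ (Submodule.factor_surjective _) ?_
  · refine (injective_iff_map_eq_zero f).mpr fun z hz => ?_
    obtain ⟨⟨a, ha⟩, rfl⟩ := Submodule.mkQ_surjective (Q.submoduleOf P) z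
    exact (Submodule.Quotient.mk_eq_zero (Q.submoduleOf P)).mpr
      ((Submodule.Quotient.mk_eq_zero Q).mp hz)
  · intro z
    obtain ⟨b, rfl⟩ := Submodule.mkQ_surjective _ z
    rw [Submodule.factor_mk, Submodule.mkQ_apply, Submodule.mkQ_apply,
      Submodule.Quotient.mk_eq_zero]
    constructor
    · intro hb
      obtain ⟨p, hp, q, hq, rfl⟩ := Submodule.mem_sup.mp hb
      refine ⟨Submodule.Quotient.mk (p := Q.submoduleOf P) ⟨p, hp⟩, ?_⟩
      rw [hf, Submodule.Quotient.eq]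
      simpa using Q.neg_mem hq
    · rintro ⟨w, hw⟩
      obtain ⟨⟨a, ha⟩, rfl⟩ := Submodule.mkQ_surjective (Q.submoduleOf P) w
      have hw' : a - b ∈ Q := (Submodule.Quotient.eq Q).mp hw
      have := Ideal.sub_mem _ (Ideal.mem_sup_left ha) (Ideal.mem_sup_right hw' : _ ∈ P ⊔ Q)
      simpa using this

/-- The length of `P / Q` drops when an ideal `U` is added to both terms, and strictly so unless
`P ∩ U ⊆ Q`. -/
theorem length_subquotient_sup_le {P Q U : Ideal R} (hQP : Q ≤ P) :
    Module.length R (Subquotient (P ⊔ U) (Q ⊔ U)) ≤ Module.length R (Subquotient P Q) ∧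
      (Module.length R (Subquotient P Q) ≠ ⊤ →
        (Module.length R (Subquotient (P ⊔ U) (Q ⊔ U)) = Module.length R (Subquotient P Q) ↔
          P ⊓ U ≤ Q)) := by
  let ι : P →ₗ[R] (P ⊔ U : Ideal R) := Submodule.inclusion le_sup_left
  let φ : Subquotient P Q →ₗ[R] Subquotient (P ⊔ U) (Q ⊔ U) :=
    Submodule.mapQ (Q.submoduleOf P) ((Q ⊔ U).submoduleOf (P ⊔ U)) ι
      fun a ha => Ideal.mem_sup_left (show (a : R) ∈ Q from ha)
  have hφ : ∀ (p : R) (hp : p ∈ P), φ (Submodule.Quotient.mk (p := Q.submoduleOf P) ⟨p, hp⟩) = 0 ↔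
      p ∈ Q ⊔ U := fun p hp =>
    Submodule.Quotient.mk_eq_zero ((Q ⊔ U).submoduleOf (P ⊔ U))
  have hsurj : Function.Surjective φ := by
    intro z
    obtain ⟨⟨b, hb⟩, rfl⟩ := Submodule.mkQ_surjective ((Q ⊔ U).submoduleOf (P ⊔ U)) z
    obtain ⟨p, hp, u, hu, rfl⟩ := Submodule.mem_sup.mp hb
    refine ⟨Submodule.Quotient.mk (p := Q.submoduleOf P) ⟨p, hp⟩, ?_⟩
    refine (Submodule.Quotient.eq ((Q ⊔ U).submoduleOf (P ⊔ U))).mpr ?_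
    change p - (p + u) ∈ Q ⊔ U
    rw [sub_add_cancel_left]
    exact Ideal.mem_sup_right (U.neg_mem hu)
  have hlen := Module.length_eq_add_of_exact (LinearMap.ker φ).subtype φ
    (Submodule.injective_subtype _) hsurj (LinearMap.exact_subtype_ker_map φ)
  refine ⟨Module.length_le_of_surjective φ hsurj, fun hfin => ?_⟩
  have hne : Module.length R (Subquotient (P ⊔ U) (Q ⊔ U)) ≠ ⊤ := fun h => by
    rw [h, add_top] at hlen
    exact hfin hlen
  have hiff : Module.length R (Subquotient (P ⊔ U) (Q ⊔ U)) = Module.length R (Subquotient P Q) ↔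
      Module.length R (LinearMap.ker φ) = 0 := by
    rw [hlen]
    constructor
    · intro h
      have h' : 0 + Module.length R (Subquotient (P ⊔ U) (Q ⊔ U)) =
          Module.length R (LinearMap.ker φ) +
            Module.length R (Subquotient (P ⊔ U) (Q ⊔ U)) := by rw [zero_add]; exact h
      exact ((ENat.add_left_injective_of_ne_top hne) h').symm
    · intro h
      rw [h, zero_add]
  rw [hiff, Module.length_eq_zero_iff, Submodule.subsingleton_iff_eq_bot, LinearMap.ker_eq_bot']
  constructor
  · rintro h p ⟨hp, hu⟩
    have := h _ ((hφ p hp).mpr (Ideal.mem_sup_right hu))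
    exact (Submodule.Quotient.mk_eq_zero (Q.submoduleOf P)).mp this
  · intro h z hz
    obtain ⟨⟨p, hp⟩, rfl⟩ := Submodule.mkQ_surjective (Q.submoduleOf P) z
    obtain ⟨q, hq, u, hu, hqu⟩ := Submodule.mem_sup.mp ((hφ p hp).mp hz)
    refine (Submodule.Quotient.mk_eq_zero (Q.submoduleOf P)).mpr ?_
    change p ∈ Q
    rw [← hqu]
    refine add_mem hq (h ⟨?_, hu⟩)
    rw [eq_sub_of_add_eq' hqu]
    exact sub_mem hp (hQP hq)

end Lengths

/-! ### Difference calculus for Hilbert polynomials. -/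

section HilbertPolynomials

/-- The polynomial `n ↦ ∑ⱼ (-1)ʲ gⱼ C(n + k - j - 1, k - j)` with Hilbert coefficients `g`. -/
def hilbertPolynomial (k : ℕ) (g : ℕ → ℤ) (n : ℕ) : ℤ :=
  ∑ j ∈ Finset.range (k + 1), (-1) ^ j * g j * ((n + k - j - 1).choose (k - j) : ℤ)

/-- Pascal's rule term by term; the new last term is constant. The difference keeps the coefficients
g_0,…,g_k, so g_1 can be read off in dimension one. -/
theorem hilbertPolynomial_succ (k : ℕ) (g : ℕ → ℤ) {n : ℕ} (hn : 1 ≤ n) :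
    hilbertPolynomial (k + 1) g (n + 1) =
      hilbertPolynomial (k + 1) g n + hilbertPolynomial k g (n + 1) := by
  unfold hilbertPolynomial
  rw [Finset.sum_range_succ, Finset.sum_range_succ _ (k + 1)]
  have h : ∀ j ∈ Finset.range (k + 1),
      (-1) ^ j * g j * ((n + 1 + (k + 1) - j - 1).choose (k + 1 - j) : ℤ) =
        (-1) ^ j * g j * ((n + (k + 1) - j - 1).choose (k + 1 - j) : ℤ) +
        (-1) ^ j * g j * ((n + 1 + k - j - 1).choose (k - j) : ℤ) := by
    intro j hj
    have hj' := Finset.mem_range.mp hj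
    obtain ⟨m, rfl⟩ : ∃ m, k = j + m := ⟨k - j, by omega⟩
    rw [show n + 1 + (j + m + 1) - j - 1 = n + m + 1 by omega, show j + m + 1 - j = m + 1 by omega,
      show n + (j + m + 1) - j - 1 = n + m by omega, show n + 1 + (j + m) - j - 1 = n + m by omega,
      show j + m - j = m by omega, Nat.choose_succ_succ]
    push_cast
    ring
  rw [Finset.sum_congr rfl h, Finset.sum_add_distrib, Nat.sub_self, Nat.choose_zero_right,
    Nat.choose_zero_right]
  ring

theorem hilbertPolynomial_zero (g : ℕ → ℤ) (n : ℕ) : hilbertPolynomial 0 g n = g 0 := by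
  simp [hilbertPolynomial]

theorem hilbertPolynomial_one (g : ℕ → ℤ) (n : ℕ) : hilbertPolynomial 1 g n = g 0 * n - g 1 := by
  simp [hilbertPolynomial, Finset.sum_range_succ]
  ring

theorem exists_hilbertPolynomial_of_difference {k : ℕ} {g : ℕ → ℤ} {h : ℕ → ℤ}
    (hh : ∀ᶠ n in atTop, h (n + 1) = h n + hilbertPolynomial k g (n + 1)) :
    ∃ g', ∀ᶠ n in atTop, h n = hilbertPolynomial (k + 1) g' n := by
  obtain ⟨N, hN⟩ := eventually_atTop.mp hh
  set M := max N 1 with hM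
  let c := h M - hilbertPolynomial (k + 1) g M
  -- The last coefficient serves as the integration constant; the sign cancels the one in the
  -- polynomial.
  let g' : ℕ → ℤ := Function.update g (k + 1) (g (k + 1) + (-1) ^ (k + 1) * c)
  have hg' : ∀ n, hilbertPolynomial (k + 1) g' n = hilbertPolynomial (k + 1) g n + c := by
    intro n
    unfold hilbertPolynomial
    rw [Finset.sum_range_succ, Finset.sum_range_succ _ (k + 1)]
    have hsum : ∀ j ∈ Finset.range (k + 1), g' j = g j := fun j hj =>
      Function.update_of_ne (Finset.mem_range.mp hj).ne _ _
    rw [Finset.sum_congr rfl fun j hj => by rw [hsum j hj]]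
    have : g' (k + 1) = g (k + 1) + (-1) ^ (k + 1) * c := Function.update_self ..
    rw [this, Nat.sub_self, Nat.choose_zero_right]
    have h1 : ((-1 : ℤ) ^ (k + 1)) * (-1) ^ (k + 1) = 1 := by
      rw [← mul_pow]; simp
    linear_combination c * h1
  refine ⟨g', eventually_atTop.mpr ⟨M, fun n hn => ?_⟩⟩
  rw [hg']
  induction n, hn using Nat.le_induction with
  | base => simp [c]
  | succ n hn ih =>
    rw [hN n (by omega), hilbertPolynomial_succ k g (by omega), ih]
    ring

theorem hilbertPolynomial_of_difference {k : ℕ} {g : ℕ → ℤ} {h h' : ℕ → ℤ}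
    (hh : ∀ᶠ n in atTop, h (n + 1) = h n + h' (n + 1))
    (hg : ∀ᶠ n in atTop, h n = hilbertPolynomial (k + 1) g n) :
    ∀ᶠ n in atTop, h' n = hilbertPolynomial k g n := by
  obtain ⟨N, hN⟩ := eventually_atTop.mp (hh.and hg)
  refine eventually_atTop.mpr ⟨max N 1 + 1, fun n hn => ?_⟩
  obtain ⟨n, rfl⟩ : ∃ m, n = m + 1 := ⟨n - 1, by omega⟩
  have h1 := (hN n (by omega)).1
  rw [(hN n (by omega)).2, (hN (n + 1) (by omega)).2, hilbertPolynomial_succ k g (by omega)] at h1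
  linarith

end HilbertPolynomials

/-! ### Hilbert functions of filtrations modulo ideals. -/

section HilbertFunctions

variable {R : Type*} [CommRing R]

/-- The length of `R / Q`, as a natural number. -/
noncomputable def colength (Q : Ideal R) : ℕ :=
  (Module.length R (R ⧸ Q)).toNat

/-- The length of `P / (P ∩ Q)`, as a natural number. -/
noncomputable def relLength (P Q : Ideal R) : ℕ :=
  (Module.length R (Subquotient P Q)).toNat

theorem relLength_eq_zero {P Q : Ideal R} (h : P ≤ Q) : relLength P Q = 0 := by
  have : Subsingleton (Subquotient P Q) := by
    refine ⟨fun a b => ?_⟩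
    obtain ⟨a, rfl⟩ := Submodule.mkQ_surjective (Q.submoduleOf P) a
    obtain ⟨b, rfl⟩ := Submodule.mkQ_surjective (Q.submoduleOf P) b
    exact (Submodule.Quotient.eq (Q.submoduleOf P)).mpr (h (sub_mem a.2 b.2))
  rw [relLength, Module.length_eq_zero, ENat.toNat_zero]

/-- The Hilbert function `n ↦ ℓ(R / (F (n + 1) + L))`. -/
noncomputable def filtrationColength (F : ℕ → Ideal R) (L : Ideal R) (n : ℕ) : ℤ :=
  colength (F (n + 1) ⊔ L)

variable [IsLocalRing R]

theorem radical_sup_le {P L : Ideal R} (h : IsLocalRing.maximalIdeal R ≤ P.radical) :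
    IsLocalRing.maximalIdeal R ≤ (P ⊔ L).radical :=
  h.trans (Ideal.radical_mono le_sup_left)

variable [IsNoetherianRing R]

theorem coe_colength {Q : Ideal R} (hQ : IsLocalRing.maximalIdeal R ≤ Q.radical) :
    (colength Q : ℕ∞) = Module.length R (R ⧸ Q) :=
  ENat.natCast_toNat (length_quotient_ne_top hQ)

theorem length_subquotient_ne_top {P Q : Ideal R} (hQ : IsLocalRing.maximalIdeal R ≤ Q.radical) :
    Module.length R (Subquotient P Q) ≠ ⊤ := fun h => by
  have := length_subquotient_add P Q
  rw [h, top_add] at this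
  exact length_quotient_ne_top hQ this

theorem coe_relLength {P Q : Ideal R} (hQ : IsLocalRing.maximalIdeal R ≤ Q.radical) :
    (relLength P Q : ℕ∞) = Module.length R (Subquotient P Q) :=
  ENat.natCast_toNat (length_subquotient_ne_top hQ)

theorem colength_eq_relLength_add {P Q : Ideal R}
    (hQ : IsLocalRing.maximalIdeal R ≤ Q.radical) :
    colength Q = relLength P Q + colength (P ⊔ Q) := by
  have h := length_subquotient_add P Q
  rw [← coe_colength hQ, ← coe_relLength hQ,
    ← coe_colength (hQ.trans (Ideal.radical_mono le_sup_right))] at h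
  exact_mod_cast h

theorem colength_eq_add_of_colon {Q Q' : Ideal R} {x : R}
    (hQ : IsLocalRing.maximalIdeal R ≤ Q.radical) (hQ' : IsLocalRing.maximalIdeal R ≤ Q'.radical)
    (h : ∀ a, x * a ∈ Q' ↔ a ∈ Q) :
    colength Q' = colength Q + colength (Q' ⊔ Ideal.span {x}) := by
  have h := length_quotient_eq_add_of_colon h
  rw [← coe_colength hQ, ← coe_colength hQ',
    ← coe_colength (hQ'.trans (Ideal.radical_mono le_sup_left))] at h
  exact_mod_cast h

theorem relLength_sup_le {P Q U : Ideal R} (hQ : IsLocalRing.maximalIdeal R ≤ Q.radical)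
    (hQP : Q ≤ P) :
    relLength (P ⊔ U) (Q ⊔ U) ≤ relLength P Q ∧
      (relLength (P ⊔ U) (Q ⊔ U) = relLength P Q ↔ P ⊓ U ≤ Q) := by
  obtain ⟨h1, h2⟩ := length_subquotient_sup_le (U := U) hQP
  have h3 := h2 (length_subquotient_ne_top hQ)
  rw [← coe_relLength hQ, ← coe_relLength (hQ.trans (Ideal.radical_mono le_sup_left))] at h1 h3
  exact ⟨by exact_mod_cast h1, by rw [← h3]; norm_cast⟩

variable {F : ℕ → Ideal R}

theorem eventually_filtrationColength_succ
    (hprim : ∀ n, IsLocalRing.maximalIdeal R ≤ (F n).radical) {x : R}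
    (hx : ∀ n, ∀ a ∈ F n, x * a ∈ F (n + 1)) {L : Ideal R} {n₀ : ℕ} (hs : IsStrictFrom F L x n₀) :
    ∀ᶠ n in atTop, filtrationColength F L (n + 1) =
      filtrationColength F L n + filtrationColength F (L ⊔ Ideal.span {x}) (n + 1) := by
  refine eventually_atTop.mpr ⟨n₀, fun n hn => ?_⟩
  have := colength_eq_add_of_colon (radical_sup_le (hprim (n + 1)))
    (radical_sup_le (hprim (n + 1 + 1)))
    fun a => ⟨hs (n + 1) (by omega) a, fun ha => mul_mem_filtration_sup hx ha⟩
  rw [sup_assoc] at this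
  unfold filtrationColength
  exact_mod_cast this

/-- With J = L + (x), both sides equal ℓ(R/(JF_{n+1} + L)): on the left by passing through F_{n+2} +
L, on the right because (JF_{n+1} + L) : x = F_{n+1} + L. Only regularity of x modulo L enters, so
it holds in every degree. -/
theorem relLength_add_filtrationColength
    (hprim : ∀ n, IsLocalRing.maximalIdeal R ≤ (F n).radical) {x : R} {L : Ideal R}
    (hreg : ∀ a, x * a ∈ L → a ∈ L)
    (hrad : IsLocalRing.maximalIdeal R ≤ (L ⊔ Ideal.span {x}).radical)
    (hmul : ∀ n, (L ⊔ Ideal.span {x}) * F n ≤ F (n + 1)) (n : ℕ) :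
    (relLength (F (n + 2) ⊔ L) ((L ⊔ Ideal.span {x}) * F (n + 1) ⊔ L) : ℤ) +
      filtrationColength F L (n + 1) =
        filtrationColength F L n + colength (L ⊔ Ideal.span {x}) := by
  have hrad' : IsLocalRing.maximalIdeal R ≤ ((L ⊔ Ideal.span {x}) * F (n + 1)).radical := by
    rw [Ideal.radical_mul]
    exact le_inf hrad (hprim _)
  have h1 := colength_eq_relLength_add (P := F (n + 2) ⊔ L) (radical_sup_le (L := L) hrad')
  rw [sup_eq_left.mpr (sup_le_sup_right (hmul (n + 1)) L)] at h1
  have h2 := colength_eq_add_of_colon (x := x) (radical_sup_le (L := L) (hprim (n + 1)))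
    (radical_sup_le (L := L) hrad') (by
      intro a
      rw [Ideal.sup_mul, sup_right_comm, sup_eq_right.mpr (Ideal.mul_le_left : L * F (n + 1) ≤ L)]
      constructor
      · intro ha
        obtain ⟨l, hl, z, hz, hlz⟩ := Submodule.mem_sup.mp ha
        obtain ⟨f, hf, rfl⟩ := Ideal.mem_span_singleton_mul.mp hz
        have : x * (a - f) ∈ L := by
          rw [mul_sub, ← hlz]
          simpa using hl
        have := Submodule.add_mem_sup hf (hreg _ this)
        simpa using this
      · intro ha
        obtain ⟨f, hf, l, hl, rfl⟩ := Submodule.mem_sup.mp ha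
        rw [mul_add]
        exact add_mem (Ideal.mem_sup_right (Ideal.mem_span_singleton_mul.mpr ⟨f, hf, rfl⟩))
          (Ideal.mem_sup_left (L.mul_mem_left _ hl)))
  rw [sup_assoc, sup_eq_right.mpr (Ideal.mul_le_left :
    (L ⊔ Ideal.span {x}) * F (n + 1) ≤ L ⊔ Ideal.span {x})] at h2
  have h3 : relLength (F (n + 2) ⊔ L) ((L ⊔ Ideal.span {x}) * F (n + 1) ⊔ L) +
      colength (F (n + 2) ⊔ L) = colength (F (n + 1) ⊔ L) + colength (L ⊔ Ideal.span {x}) :=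
    h1.symm.trans h2
  change (_ : ℤ) + (colength (F (n + 2) ⊔ L) : ℤ) = (colength (F (n + 1) ⊔ L) : ℤ) + _
  exact_mod_cast h3

end HilbertFunctions

/-! ### The first Hilbert coefficient. -/

section HilbertCoefficients

variable {R : Type*} [CommRing R] [IsLocalRing R] [IsNoetherianRing R]

section Descent

variable {F : ℕ → Ideal R} {y : ℕ → R} {k : ℕ}

theorem exists_hilbertPolynomial_of_initialIdeal
    (hprim : ∀ n, IsLocalRing.maximalIdeal R ≤ (F n).radical)
    (hy : ∀ j < k, ∀ n, ∀ a ∈ F n, y j * a ∈ F (n + 1))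
    (hs : ∀ j < k, ∃ n₀, IsStrictFrom F (initialIdeal y j) (y j) n₀) {m : ℕ}
    (h : ∃ g, ∀ᶠ n in atTop,
      filtrationColength F (initialIdeal y k) n = hilbertPolynomial m g n) :
    ∃ g, ∀ᶠ n in atTop,
      filtrationColength F (initialIdeal y 0) n = hilbertPolynomial (m + k) g n := by
  induction k generalizing m with
  | zero => exact h
  | succ k ih =>
    obtain ⟨g, hg⟩ := h
    obtain ⟨n₀, hn₀⟩ := hs k k.lt_succ_self
    have hd := eventually_filtrationColength_succ hprim (hy k k.lt_succ_self) hn₀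
    rw [← initialIdeal_succ] at hd
    have := exists_hilbertPolynomial_of_difference (k := m) (g := g)
      (h := filtrationColength F (initialIdeal y k)) (by
        filter_upwards [hd, (tendsto_add_atTop_nat 1).eventually hg] with n h1 h2
        rw [h1, h2])
    have := ih (fun j hj => hy j (by omega)) (fun j hj => hs j (by omega)) this
    rwa [show m + (k + 1) = m + 1 + k by ring]

theorem hilbertPolynomial_initialIdeal
    (hprim : ∀ n, IsLocalRing.maximalIdeal R ≤ (F n).radical)
    (hy : ∀ j < k, ∀ n, ∀ a ∈ F n, y j * a ∈ F (n + 1))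
    (hs : ∀ j < k, ∃ n₀, IsStrictFrom F (initialIdeal y j) (y j) n₀) {m : ℕ} {g : ℕ → ℤ}
    (h : ∀ᶠ n in atTop,
      filtrationColength F (initialIdeal y 0) n = hilbertPolynomial (m + k) g n) :
    ∀ᶠ n in atTop, filtrationColength F (initialIdeal y k) n = hilbertPolynomial m g n := by
  induction k generalizing m with
  | zero => exact h
  | succ k ih =>
    obtain ⟨n₀, hn₀⟩ := hs k k.lt_succ_self
    have hd := eventually_filtrationColength_succ hprim (hy k k.lt_succ_self) hn₀
    rw [← initialIdeal_succ] at hd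
    rw [show m + (k + 1) = m + 1 + k by ring] at h
    exact hilbertPolynomial_of_difference hd
      (ih (fun j hj => hy j (by omega)) (fun j hj => hs j (by omega)) h)

end Descent

/-- Partial sums telescope to M e + h(0) - h(M). Since V eventually vanishes, e = g_0, and h(M) =
g_0 M - g_1 leaves h(0) + g_1. -/
theorem sum_range_eq_of_difference {V h : ℕ → ℤ} {e : ℤ} {N : ℕ} {g : ℕ → ℤ}
    (hV : ∀ n, V n + h (n + 1) = h n + e) (hN : ∀ n ≥ N, V n = 0)
    (hg : ∀ᶠ n in atTop, h n = hilbertPolynomial 1 g n) :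
    ∑ n ∈ Finset.range N, V n = h 0 + g 1 := by
  obtain ⟨M, hM⟩ := eventually_atTop.mp hg
  have hsum : ∀ M, ∑ n ∈ Finset.range M, V n = M * e + h 0 - h M := by
    intro M
    induction M with
    | zero => simp
    | succ M ih =>
      rw [Finset.sum_range_succ, ih]
      push_cast
      linear_combination hV M
  have hle : N ≤ max N M := le_max_left _ _
  have h1 : ∑ n ∈ Finset.range N, V n = ∑ n ∈ Finset.range (max N M), V n :=
    Finset.sum_subset (Finset.range_subset_range.mpr hle) fun n _ hn =>
      hN n (by simpa using hn)
  have h2 := hM (max N M) (le_max_right _ _)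
  have h3 := hM (max N M + 1) ((le_max_right _ _).trans (Nat.le_succ _))
  have h4 := hV (max N M)
  rw [hN _ hle] at h4
  rw [hilbertPolynomial_one] at h2 h3
  rw [h1, hsum]
  push_cast at h2 h3 ⊢
  have he : e = g 0 := by linarith
  rw [h2, he]
  ring

theorem eventually_hilbertPolynomial_one_of_difference {V h : ℕ → ℤ} {e : ℤ} {N : ℕ}
    (hV : ∀ n, V n + h (n + 1) = h n + e) (hN : ∀ n ≥ N, V n = 0) :
    ∃ g, ∀ᶠ n in atTop, h n = hilbertPolynomial 1 g n := by
  refine exists_hilbertPolynomial_of_difference (k := 0) (g := fun _ => e)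
    (eventually_atTop.mpr ⟨N, fun n hn => ?_⟩)
  rw [hilbertPolynomial_zero, ← hV n, hN n hn, zero_add]

theorem hasSum_length_subquotient {P Q : ℕ → Ideal R} {N : ℕ}
    (hQ : ∀ n, IsLocalRing.maximalIdeal R ≤ (Q n).radical) (hN : ∀ n ≥ N, P n ≤ Q n) :
    HasSum (fun n => Module.length R (Subquotient (P n) (Q n)))
      ((∑ n ∈ Finset.range N, relLength (P n) (Q n) : ℕ) : ℕ∞) := by
  have h : ∀ n, Module.length R (Subquotient (P n) (Q n)) = (relLength (P n) (Q n) : ℕ∞) :=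
    fun n => (coe_relLength (hQ n)).symm
  simp only [h, Nat.cast_sum]
  refine hasSum_sum_of_ne_finset_zero fun n hn => ?_
  rw [relLength_eq_zero (hN n (by simpa using hn)), Nat.cast_zero]

theorem sum_range_eq_iff_of_le {u v : ℕ → ℕ} {N : ℕ} (hle : ∀ n, u n ≤ v n)
    (hN : ∀ n ≥ N, v n = 0) :
    ∑ n ∈ Finset.range N, u n = ∑ n ∈ Finset.range N, v n ↔ ∀ n, u n = v n := by
  rw [Finset.sum_eq_sum_iff_of_le fun n _ => hle n]
  refine ⟨fun h n => ?_, fun h n _ => h n⟩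
  by_cases hn : n < N
  · exact h n (Finset.mem_range.mpr hn)
  · have := hle n
    have := hN n (by omega)
    omega

/-- Bounds for the first Hilbert coefficient of a filtration `F` of ideals which is eventually
multiplied by `J = (y₀, …, y_k)`, and characterisations of equality. -/
theorem firstHilbertCoeff_bounds {F : ℕ → Ideal R} {y : ℕ → R} {k : ℕ} (h0 : F 0 = ⊤)
    (hprim : ∀ n, IsLocalRing.maximalIdeal R ≤ (F n).radical)
    (hrad : IsLocalRing.maximalIdeal R ≤ (initialIdeal y (k + 1)).radical)
    (hreg : ∀ j < k + 1, ∀ a, y j * a ∈ initialIdeal y j → a ∈ initialIdeal y j)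
    (hs : ∀ j < k + 1, ∃ n₀, IsStrictFrom F (initialIdeal y j) (y j) n₀)
    (hmul : ∀ n, initialIdeal y (k + 1) * F n ≤ F (n + 1))
    (hJF : ∃ N, ∀ n ≥ N, F (n + 1) ≤ initialIdeal y (k + 1) * F n) :
    (∃ g, ∀ᶠ n in atTop,
      filtrationColength F (initialIdeal y 0) n = hilbertPolynomial (k + 1) g n) ∧
    ∃ S T : ℕ,
      HasSum (fun n => Module.length R (Subquotient
        (F (n + 2) ⊔ initialIdeal y (k + 1)) (initialIdeal y (k + 1)))) (S : ℕ∞) ∧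
      HasSum (fun n => Module.length R (Subquotient
        (F (n + 2)) (initialIdeal y (k + 1) * F (n + 1)))) (T : ℕ∞) ∧
      ∀ g : ℕ → ℤ, (∀ᶠ n in atTop,
        filtrationColength F (initialIdeal y 0) n = hilbertPolynomial (k + 1) g n) →
        ((S : ℤ) - colength (F 1) ≤ g 1 ∧
          (g 1 = (S : ℤ) - colength (F 1) ↔
            ∀ j < k + 1, IsStrictFrom F (initialIdeal y j) (y j) 0)) ∧
        (g 1 ≤ (T : ℤ) - colength (F 1) ∧
          (g 1 = (T : ℤ) - colength (F 1) ↔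
            ∀ j < k, IsStrictFrom F (initialIdeal y j) (y j) 0)) := by
  set J := initialIdeal y (k + 1) with hJdef
  set L := initialIdeal y k with hLdef
  have hJ : J = L ⊔ Ideal.span {y k} := initialIdeal_succ y k
  have hLJ : L ≤ J := hJ ▸ le_sup_left
  have hy : ∀ j < k + 1, ∀ n, ∀ a ∈ F n, y j * a ∈ F (n + 1) := fun j hj n a ha =>
    hmul n (Ideal.mul_mem_mul (mem_initialIdeal y hj) ha)
  have hJ1 : J ≤ F 1 := by simpa [h0] using hmul 0
  obtain ⟨N, hN⟩ := hJF
  have hradJF : ∀ n, IsLocalRing.maximalIdeal R ≤ (J * F n).radical := fun n => by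
    rw [Ideal.radical_mul]
    exact le_inf hrad (hprim n)
  have hFJ : ∀ n ≥ N, F (n + 2) ≤ J * F (n + 1) := fun n hn => hN (n + 1) (by omega)
  -- s and t are the summands of the two bounds; v, computed modulo L, lies between them and sums
  -- exactly to g_1 plus ℓ(R/F_1).
  let s : ℕ → ℕ := fun n => relLength (F (n + 2) ⊔ J) J
  let v : ℕ → ℕ := fun n => relLength (F (n + 2) ⊔ L) (J * F (n + 1) ⊔ L)
  let t : ℕ → ℕ := fun n => relLength (F (n + 2)) (J * F (n + 1))
  have hv0 : ∀ n ≥ N, v n = 0 := fun n hn => relLength_eq_zero (sup_le_sup_right (hFJ n hn) L)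
  have ht0 : ∀ n ≥ N, t n = 0 := fun n hn => relLength_eq_zero (hFJ n hn)
  have hsv : ∀ n, s n ≤ v n ∧ (s n = v n ↔ (F (n + 2) ⊔ L) ⊓ J ≤ J * F (n + 1) ⊔ L) := by
    intro n
    have := relLength_sup_le (P := F (n + 2) ⊔ L) (Q := J * F (n + 1) ⊔ L) (U := J)
      (radical_sup_le (hradJF _)) (sup_le_sup_right (hmul (n + 1)) L)
    rwa [sup_assoc, sup_eq_right.mpr hLJ, sup_assoc, sup_eq_right.mpr hLJ,
      sup_eq_right.mpr (Ideal.mul_le_left : J * F (n + 1) ≤ J)] at this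
  have hvt : ∀ n, v n ≤ t n ∧ (v n = t n ↔ F (n + 2) ⊓ L ≤ J * F (n + 1)) := fun n =>
    relLength_sup_le (hradJF _) (hmul (n + 1))
  have hV : ∀ n, (v n : ℤ) + filtrationColength F L (n + 1) =
      filtrationColength F L n + colength J := by
    intro n
    have := relLength_add_filtrationColength hprim (hreg k k.lt_succ_self) (hJ ▸ hrad)
      (hJ ▸ hmul) n
    rwa [← hJ] at this
  have hv0' : ∀ n ≥ N, (v n : ℤ) = 0 := fun n hn => by rw [hv0 n hn, Nat.cast_zero]
  refine ⟨?_, ∑ n ∈ Finset.range N, s n, ∑ n ∈ Finset.range N, t n,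
    hasSum_length_subquotient (fun _ => hrad)
      (fun n hn => sup_le ((hFJ n hn).trans Ideal.mul_le_left) le_rfl),
    hasSum_length_subquotient (fun _ => hradJF _) hFJ, fun g hg => ?_⟩
  · have := exists_hilbertPolynomial_of_initialIdeal (k := k) (m := 1) hprim
      (fun j hj => hy j (by omega)) (fun j hj => hs j (by omega))
      (eventually_hilbertPolynomial_one_of_difference hV hv0')
    rwa [add_comm] at this
  · rw [add_comm] at hg
    have hg1 := sum_range_eq_of_difference hV hv0' (hilbertPolynomial_initialIdeal hprim
      (fun j hj => hy j (by omega)) (fun j hj => hs j (by omega)) hg)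
    have hc : filtrationColength F L 0 = colength (F 1) := by
      unfold filtrationColength
      rw [zero_add, sup_eq_left.mpr (hLJ.trans hJ1)]
    rw [hc, ← Nat.cast_sum] at hg1
    have hle1 := Finset.sum_le_sum fun n (_ : n ∈ Finset.range N) => (hsv n).1
    have hle2 := Finset.sum_le_sum fun n (_ : n ∈ Finset.range N) => (hvt n).1
    have heq1 := sum_range_eq_iff_of_le (fun n => (hsv n).1) hv0
    have heq2 := sum_range_eq_iff_of_le (fun n => (hvt n).1) ht0
    have hstrict1 : (∀ n, s n = v n) ↔
        ∀ j < k + 1, IsStrictFrom F (initialIdeal y j) (y j) 0 := by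
      have h := sup_inf_le_iff_isStrictFrom h0 (hreg k k.lt_succ_self)
      rw [← initialIdeal_succ] at h
      rw [forall_congr' fun n => (hsv n).2, h]
      exact ⟨forall_isStrictFrom_of_last h0 hy hs, fun h => h k k.lt_succ_self⟩
    have hstrict2 : (∀ n, v n = t n) ↔ ∀ j < k, IsStrictFrom F (initialIdeal y j) (y j) 0 := by
      rw [forall_congr' fun n => (hvt n).2]
      exact inf_le_initialIdeal_succ_mul_iff h0 hy hreg
    rw [← hstrict1, ← hstrict2, ← heq1, ← heq2]
    omega

end HilbertCoefficients

/-! ### Transport of depth and dimension along isomorphisms. -/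

section Transport

variable {A : Type*} [CommRing A] {M N : Type*} [AddCommGroup M] [Module A M] [AddCommGroup N]
  [Module A N]

theorem idealDepth_congr (𝔞 : Ideal A) (e : M ≃ₗ[A] N) : idealDepth 𝔞 M = idealDepth 𝔞 N := by
  simp only [idealDepth, e.isRegular_congr]

theorem SubmoduleType.idealDepth_quotient (𝔞 : Ideal A) {P Q : Submodule A M}
    {K : Submodule A (SubmoduleType P)} (hK : K = Q.comap (SubmoduleType.subtype P)) :
    idealDepth 𝔞 (SubmoduleType P ⧸ K) = idealDepth 𝔞 (Subquotient P Q) := by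
  subst hK
  exact idealDepth_congr 𝔞 (SubmoduleType.quotientEquiv P Q)

theorem SubmoduleType.supportDim_quotient {P Q : Submodule A M}
    {K : Submodule A (SubmoduleType P)} (hK : K = Q.comap (SubmoduleType.subtype P)) :
    Module.supportDim A (SubmoduleType P ⧸ K) = Module.supportDim A (Subquotient P Q) := by
  subst hK
  exact Module.supportDim_eq_of_equiv (SubmoduleType.quotientEquiv P Q)

end Transport

/-! ### The case L = 0. -/

section AssocGraded

variable {R : Type*} [CommRing R] {I : Ideal R}

theorem gradedKernel_initialIdeal_zero (F : I.Filtration R) (y : ℕ → R) :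
    gradedKernel F (initialIdeal y 0) =
      Submodule.comap (SubmoduleType.subtype F.submodule) (shiftFiltration F).submodule := by
  have : shiftSupFiltration F (initialIdeal y 0) = shiftFiltration F := by
    refine Ideal.Filtration.ext (funext fun n => ?_)
    change F.N (n + 1) ⊔ initialIdeal y 0 = F.N (n + 1)
    rw [initialIdeal_zero, sup_bot_eq]
  rw [gradedKernel, this]

theorem idealDepth_assocGraded (𝔞 : Ideal (reesAlgebra I)) (F : I.Filtration R) (y : ℕ → R) :
    idealDepth 𝔞 (assocGraded F) = idealDepth 𝔞 (quotientGraded F (initialIdeal y 0)) :=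
  (SubmoduleType.idealDepth_quotient 𝔞 (gradedKernel_initialIdeal_zero F y)).symm

theorem supportDim_assocGraded (F : I.Filtration R) (y : ℕ → R) :
    Module.supportDim (reesAlgebra I) (assocGraded F) =
      Module.supportDim (reesAlgebra I) (quotientGraded F (initialIdeal y 0)) :=
  (SubmoduleType.supportDim_quotient (gradedKernel_initialIdeal_zero F y)).symm

end AssocGraded

/-! ### The mixed filtration and superficial elements. -/

section MixedFiltration

variable {R : Type*} [CommRing R]

theorem mem_of_pow_mul_mem {L : Ideal R} {x : R} (hreg : ∀ a, x * a ∈ L → a ∈ L) (n : ℕ) {a : R}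
    (h : x ^ n * a ∈ L) : a ∈ L := by
  induction n with
  | zero => simpa using h
  | succ n ih => exact ih (hreg _ (by rwa [pow_succ', mul_assoc] at h))

/-- By Nakayama, F n ⊆ F(n+1) + L would give F n ⊆ L. But x^n ∈ F n, and x is a nonzerodivisor
modulo the proper ideal L. -/
theorem not_le_succ_sup [IsNoetherianRing R] [IsLocalRing R] {F : ℕ → Ideal R} (h0 : F 0 = ⊤)
    {L : Ideal R} (hL : L ≠ ⊤) {x : R} (hreg : ∀ a, x * a ∈ L → a ∈ L)
    (hx : ∀ n, ∀ a ∈ F n, x * a ∈ F (n + 1)) {n : ℕ}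
    (hF : F (n + 1) ≤ IsLocalRing.maximalIdeal R * F n) : ¬ F n ≤ F (n + 1) ⊔ L := by
  intro h
  have hle : F n ≤ L := Submodule.le_of_le_smul_of_le_jacobson_bot (IsNoetherian.noetherian _)
    (IsLocalRing.maximalIdeal_le_jacobson ⊥)
    (h.trans (sup_le (hF.trans le_sup_right) le_sup_left))
  have hpow := pow_mul_mem_filtration hx n (n := 0) (a := 1) (by rw [h0]; trivial)
  rw [zero_add] at hpow
  exact hL ((Ideal.eq_top_iff_one L).mpr (mem_of_pow_mul_mem hreg n (hle hpow)))

variable {I₁ I₂ J : Ideal R}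

theorem mixedFiltration_N_succ (n : ℕ) : (mixedFiltration I₁ I₂).N (n + 1) = I₁ * I₂ ^ n := rfl

theorem mixedFiltration_N_one : (mixedFiltration I₁ I₂).N 1 = I₁ := by
  rw [mixedFiltration_N_succ, pow_zero, mul_one]

/-- Only the exponent s = 1 of superficiality is needed; regularity of x modulo L then cancels it.
-/
theorem IsSuperficial.isStrictFrom {L : Ideal R} {x : R}
    (h : IsSuperficial (I₂.map (Ideal.Quotient.mk L)) (I₁.map (Ideal.Quotient.mk L))
      (Ideal.Quotient.mk L x)) (hreg : ∀ a, x * a ∈ L → a ∈ L) :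
    ∃ n₀, IsStrictFrom (mixedFiltration I₁ I₂).N L x n₀ := by
  obtain ⟨-, r₀, -, hr⟩ := h
  refine ⟨r₀ + 1, fun n hn a ha => ?_⟩
  obtain ⟨m, rfl⟩ : ∃ m, n = m + 1 := ⟨n - 1, by omega⟩
  rw [mixedFiltration_N_succ] at ha ⊢
  have h1 := hr (m + 1) (by omega) 1
  rw [Nat.add_sub_cancel, pow_one, ← Ideal.map_pow, ← Ideal.map_mul, ← Ideal.map_pow,
    ← Ideal.map_mul] at h1
  obtain ⟨f, hf, l, hl, hfl⟩ := Submodule.mem_sup.mp ha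
  have h2 : Ideal.Quotient.mk L (x * a) ∈
      Ideal.span {Ideal.Quotient.mk L x} ⊓ (I₁ * I₂ ^ (m + 1)).map (Ideal.Quotient.mk L) := by
    refine ⟨?_, ?_⟩
    · rw [map_mul]
      exact Ideal.mul_mem_right _ _ (Ideal.mem_span_singleton_self _)
    · rw [← hfl, map_add, Ideal.Quotient.eq_zero_iff_mem.mpr hl, add_zero]
      exact Ideal.mem_map_of_mem _ hf
  rw [h1] at h2
  obtain ⟨w, hw, hxw⟩ := Ideal.mem_span_singleton_mul.mp h2
  obtain ⟨b, hb, rfl⟩ :=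
    (Ideal.mem_map_iff_of_surjective _ Ideal.Quotient.mk_surjective).mp hw
  rw [← map_mul, Ideal.Quotient.eq, ← mul_sub] at hxw
  have h3 := hreg _ hxw
  have := Submodule.add_mem_sup hb (L.neg_mem h3)
  simpa using this

theorem IsReduction.exists_mixedFiltration_succ (h : IsReduction J I₂) :
    ∃ N, ∀ n ≥ N, (mixedFiltration I₁ I₂).N (n + 1) = J * (mixedFiltration I₁ I₂).N n := by
  obtain ⟨-, r, hr⟩ := h
  refine ⟨r + 1, fun n hn => ?_⟩
  obtain ⟨m, rfl⟩ : ∃ m, n = r + m + 1 := ⟨n - r - 1, by omega⟩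
  rw [mixedFiltration_N_succ, mixedFiltration_N_succ, show r + m + 1 = r + 1 + m by ring,
    pow_add, ← hr, pow_add]
  ring

theorem IsReduction.radical_le (h : IsReduction J I₂) : I₂.radical ≤ J.radical := by
  obtain ⟨-, r, hr⟩ := h
  rw [← Ideal.radical_pow I₂ r.succ_ne_zero, Nat.succ_eq_add_one, ← hr]
  exact Ideal.radical_mono Ideal.mul_le_left

/-- J ⊆ I₁ ∩ I₂, so F(n+1) = J F(n) for large n makes the filtration stable. -/
theorem IsReduction.finite_filtrationModule [IsNoetherianRing R] (h : IsReduction J I₂)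
    (hJ : J ≤ I₁) :
    Module.Finite (reesAlgebra (I₁ ⊓ I₂)) (filtrationModule (mixedFiltration I₁ I₂)) := by
  refine SubmoduleType.finite ((Ideal.Filtration.submodule_fg_iff_stable _
    fun i => IsNoetherian.noetherian _).mpr ?_)
  obtain ⟨N, hN⟩ := h.exists_mixedFiltration_succ (I₁ := I₁)
  refine ⟨N, fun n hn => le_antisymm ((mixedFiltration I₁ I₂).smul_le n) ?_⟩
  rw [hN n hn]
  exact Ideal.mul_mono_left (le_inf hJ h.1)

theorem le_radical_mixedFiltration {𝔭 : Ideal R} (h₁ : 𝔭 ≤ I₁.radical) (h₂ : 𝔭 ≤ I₂.radical) :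
    ∀ n, 𝔭 ≤ Ideal.radical ((mixedFiltration I₁ I₂).N n)
  | 0 => by
    change 𝔭 ≤ (⊤ : Ideal R).radical
    rw [Ideal.radical_top]
    exact le_top
  | n + 1 => by
    rw [mixedFiltration_N_succ, Ideal.radical_mul]
    refine le_inf h₁ (h₂.trans ?_)
    rcases eq_or_ne n 0 with rfl | hn
    · rw [pow_zero, Ideal.one_eq_top, Ideal.radical_top]
      exact le_top
    · rw [Ideal.radical_pow I₂ hn]

theorem mixedFiltration_succ_le (n : ℕ) (hn : 1 ≤ n) :
    (mixedFiltration I₁ I₂).N (n + 1) ≤ I₂ * (mixedFiltration I₁ I₂).N n := by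
  obtain ⟨m, rfl⟩ : ∃ m, n = m + 1 := ⟨n - 1, by omega⟩
  rw [mixedFiltration_N_succ, mixedFiltration_N_succ, pow_succ]
  apply le_of_eq
  ring

theorem isMixedHilbertCoeff_iff [IsNoetherianRing R] [IsLocalRing R]
    (h₁ : IsLocalRing.maximalIdeal R ≤ I₁.radical) (h₂ : IsLocalRing.maximalIdeal R ≤ I₂.radical)
    (y : ℕ → R) (d : ℕ) (g : ℕ → ℤ) :
    IsMixedHilbertCoeff I₁ I₂ d g ↔ ∀ᶠ n in atTop,
      filtrationColength (mixedFiltration I₁ I₂).N (initialIdeal y 0) n =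
        hilbertPolynomial d g n := by
  refine eventually_congr (Eventually.of_forall fun n => ?_)
  rw [filtrationColength, initialIdeal_zero, sup_bot_eq, mixedFiltration_N_succ,
    ← coe_colength (Q := I₁ * I₂ ^ n) (le_radical_mixedFiltration h₁ h₂ (n + 1))]
  constructor
  · rintro ⟨h, hh, hg⟩
    rwa [Nat.cast_inj.mp hh]
  · exact fun h => ⟨_, rfl, h⟩

end MixedFiltration

/-! ### Finite sequences indexed by ℕ. -/

section ExtendByZero

variable {R : Type*} [CommRing R]

/-- The extension of a finite sequence by zero. -/
def extendByZero {d : ℕ} (x : Fin d → R) (n : ℕ) : R :=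
  if h : n < d then x ⟨n, h⟩ else 0

theorem extendByZero_fin {d : ℕ} (x : Fin d → R) (i : Fin d) : extendByZero x i = x i :=
  dif_pos i.2

theorem initialIdeal_extendByZero {d : ℕ} (x : Fin d → R) :
    initialIdeal (extendByZero x) d = Ideal.span (Set.range x) := by
  refine congrArg Ideal.span (Set.ext fun a => ⟨?_, ?_⟩)
  · rintro ⟨n, hn, rfl⟩
    exact ⟨⟨n, hn⟩, (extendByZero_fin x ⟨n, hn⟩).symm⟩
  · rintro ⟨i, rfl⟩
    exact ⟨i, i.2, extendByZero_fin x i⟩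

theorem initialIdeal_extendByZero_fin {d : ℕ} (x : Fin d → R) (i : Fin d) :
    initialIdeal (extendByZero x) i = Ideal.span (x '' {j | j < i}) := by
  refine congrArg Ideal.span (Set.ext fun a => ⟨?_, ?_⟩)
  · rintro ⟨n, hn, rfl⟩
    have hn' : n < i := hn
    exact ⟨⟨n, hn'.trans i.2⟩, hn', (extendByZero_fin x ⟨n, hn'.trans i.2⟩).symm⟩
  · rintro ⟨j, hj, rfl⟩
    exact ⟨j, hj, extendByZero_fin x j⟩

theorem isCohenMacaulayWrt_iff_le {A : Type*} [CommRing A] {𝔞 : Ideal A} {M : Type*}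
    [AddCommGroup M] [Module A M] {d : ℕ} (hdim : Module.supportDim A M = d)
    (hle : idealDepth 𝔞 M ≤ d) : IsCohenMacaulayWrt 𝔞 M ↔ (d : ℕ∞) ≤ idealDepth 𝔞 M := by
  have : ((d : ℕ) : WithBot ℕ∞) = ((d : ℕ∞) : WithBot ℕ∞) := rfl
  rw [IsCohenMacaulayWrt, hdim, this, WithBot.coe_inj]
  exact ⟨fun h => h.ge, fun h => le_antisymm hle h⟩

end ExtendByZero

/-! ### The main theorem. -/

theorem mainTheorem3 {R : Type*} [CommRing R] [IsNoetherianRing R] [IsLocalRing R]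
    [Infinite (IsLocalRing.ResidueField R)]
    (hCM : IsCohenMacaulayWrt (IsLocalRing.maximalIdeal R) R)
    (d : ℕ) (hd : 1 ≤ d) (hdim : ringKrullDim R = d)
    (I₁ I₂ : Ideal R)
    (hI₁ : I₁.radical = IsLocalRing.maximalIdeal R)
    (hI₂ : I₂.radical = IsLocalRing.maximalIdeal R)
    (x : Fin d → R)
    (hred : IsMinimalReduction (Ideal.span (Set.range x)) I₂)
    (hsup : IsSuperficialSequence I₂ I₁ x)
    (hx : Ideal.span (Set.range x) ≤ I₁) :
    (∃ g : ℕ → ℤ, IsMixedHilbertCoeff I₁ I₂ d g) ∧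
    ∃ S T c : ℕ,
      HasSum (fun n : ℕ => Module.length R (Subquotient
        (I₁ * I₂ ^ (n + 1) ⊔ Ideal.span (Set.range x)) (Ideal.span (Set.range x)))) (S : ℕ∞) ∧
      HasSum (fun n : ℕ => Module.length R (Subquotient
        (I₁ * I₂ ^ (n + 1)) (Ideal.span (Set.range x) * (I₁ * I₂ ^ n)))) (T : ℕ∞) ∧
      Module.length R (R ⧸ I₁) = (c : ℕ∞) ∧
      ∀ g : ℕ → ℤ, IsMixedHilbertCoeff I₁ I₂ d g →
        ((S : ℤ) - c ≤ g 1 ∧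
          (g 1 = (S : ℤ) - c ↔
            IsCohenMacaulayWrt (reesMaxIdeal (I₁ ⊓ I₂)) (mixedGraded I₁ I₂))) ∧
        (g 1 ≤ (T : ℤ) - c ∧
          (g 1 = (T : ℤ) - c ↔
            ((d - 1 : ℕ) : ℕ∞) ≤ idealDepth (reesMaxIdeal (I₁ ⊓ I₂)) (mixedGraded I₁ I₂))) := by
  obtain ⟨k, rfl⟩ : ∃ k, d = k + 1 := ⟨d - 1, by omega⟩
  have hredn : IsReduction (Ideal.span (Set.range x)) I₂ := hred.prop
  set y := extendByZero x with hydef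
  have hJ : Ideal.span (Set.range x) = initialIdeal y (k + 1) :=
    (initialIdeal_extendByZero x).symm
  rw [hJ] at hredn hx ⊢
  set K := I₁ ⊓ I₂ with hK
  set F := mixedFiltration I₁ I₂ with hF
  have hm₁ : IsLocalRing.maximalIdeal R ≤ I₁.radical := hI₁.ge
  have hm₂ : IsLocalRing.maximalIdeal R ≤ I₂.radical := hI₂.ge
  have hmK : IsLocalRing.maximalIdeal R ≤ K.radical := by
    rw [hK, Ideal.radical_inf]
    exact le_inf hm₁ hm₂
  have hmJ : IsLocalRing.maximalIdeal R ≤ (initialIdeal y (k + 1)).radical :=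
    hm₂.trans hredn.radical_le
  have hI₂m : I₂ ≤ IsLocalRing.maximalIdeal R := Ideal.le_radical.trans hI₂.le
  have hI₁ne : I₁ ≠ ⊤ := fun h => by
    rw [h, Ideal.radical_top] at hI₁
    exact (IsLocalRing.maximalIdeal.isMaximal R).ne_top hI₁.symm
  have hJK : initialIdeal y (k + 1) ≤ K := le_inf hx hredn.1
  have hyK : ∀ j < k + 1, y j ∈ K := fun j hj => hJK (mem_initialIdeal y hj)
  have h0 : F.N 0 = ⊤ := rfl
  have hF1 : F.N 1 = I₁ := mixedFiltration_N_one
  have hy1 : ∀ j < k + 1, y j ∈ F.N 1 := fun j hj => hF1.ge (hyK j hj).1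
  have hne1 : F.N 1 ≠ ⊤ := hF1.trans_ne hI₁ne
  have hprim := le_radical_mixedFiltration hm₁ hm₂
  have hfin := hredn.finite_filtrationModule hx
  obtain ⟨N, hN⟩ := hredn.exists_mixedFiltration_succ (I₁ := I₁)
  have hdepth : HasWeaklyRegular (IsLocalRing.maximalIdeal R) (k + 1) R := by
    refine hasWeaklyRegular_of_le_idealDepth (ge_of_eq ?_)
    rw [IsCohenMacaulayWrt, Module.supportDim_self_eq_ringKrullDim, hdim] at hCM
    exact WithBot.coe_inj.mp hCM
  have hreg := mem_initialIdeal_of_mul_mem (fun j hj => hI₂m (hyK j hj).2) hmJ hdepth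
  have hs : ∀ j < k + 1, ∃ n₀, IsStrictFrom F.N (initialIdeal y j) (y j) n₀ := by
    intro j hj
    have hL : initialIdeal y j = _ := initialIdeal_extendByZero_fin x ⟨j, hj⟩
    have hyj : y j = x ⟨j, hj⟩ := extendByZero_fin x ⟨j, hj⟩
    have hr := hreg j hj
    rw [hL, hyj] at hr ⊢
    exact IsSuperficial.isStrictFrom (hsup ⟨j, hj⟩).2 hr
  have hmul : ∀ n, initialIdeal y (k + 1) * F.N n ≤ F.N (n + 1) := fun n =>
    (Ideal.mul_mono_left hJK).trans (F.smul_le n)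
  have hLne : initialIdeal y k ≠ ⊤ := fun h => (IsLocalRing.maximalIdeal.isMaximal R).ne_top
    (top_le_iff.mp (h ▸ (initialIdeal_mono y k.le_succ).trans (hredn.1.trans hI₂m)))
  have hne : ∀ n₁, ∃ n ≥ n₁, ¬ F.N n ≤ F.N (n + 1) ⊔ initialIdeal y k := fun n₁ =>
    ⟨n₁ + 1, n₁.le_succ, not_le_succ_sup h0 hLne (hreg k k.lt_succ_self)
      (mem_filtration_mul (hyK k k.lt_succ_self))
      ((mixedFiltration_succ_le _ (by omega)).trans (Ideal.mul_mono_left hI₂m))⟩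
  have hint : ∀ a ∈ K, ∃ p : Polynomial R, p.Monic ∧
      (∀ i, p.coeff i ∈ initialIdeal y (k + 1) ^ (p.natDegree - i)) ∧ p.eval a = 0 := by
    intro a ha
    obtain ⟨r, hr⟩ := hredn.2
    -- J I₂^r = I₂^(r+1) gives a I₂^r ⊆ J I₂^r for a ∈ I₂, and I₂^r is faithful because it contains
    -- a power of the nonzerodivisor y_0.
    refine exists_monic_coeff_mem_pow_eval_eq_zero (N := I₂ ^ r) (fun c hc => ?_) fun b hb => ?_
    · have h := hc _ (Ideal.pow_mem_pow (hyK 0 k.succ_pos).2 r)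
      have h' : y 0 ^ r * c ∈ initialIdeal y 0 := by
        rw [mul_comm, h]
        exact zero_mem _
      have := mem_of_pow_mul_mem (hreg 0 k.succ_pos) r h'
      rwa [initialIdeal_zero, Ideal.mem_bot] at this
    · rw [hr, pow_succ']
      exact Ideal.mul_mem_mul ha.2 hb
  obtain ⟨hex, S, T, hS, hT, hST⟩ := firstHilbertCoeff_bounds h0 hprim hmJ hreg hs hmul
    ⟨N, fun n hn => (hN n hn).le⟩
  have hdimG : Module.supportDim (reesAlgebra K) (mixedGraded I₁ I₂) = (k + 1 : ℕ) :=
    (supportDim_assocGraded F y).trans (supportDim_quotientGraded hmK hfin hyK hs hne hint)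
  have hdepthG : idealDepth (reesMaxIdeal K) (mixedGraded I₁ I₂) =
      idealDepth (reesMaxIdeal K) (quotientGraded F (initialIdeal y 0)) :=
    idealDepth_assocGraded _ F y
  have hleG : idealDepth (reesMaxIdeal K) (mixedGraded I₁ I₂) ≤ (k + 1 : ℕ) :=
    hdepthG.trans_le (idealDepth_quotientGraded_le hmK hfin hyK h0 hy1 hne1 hs
      (n₁ := N + 1) fun n hn => by
      obtain ⟨m, rfl⟩ : ∃ m, n = m + 1 := ⟨n - 1, by omega⟩
      exact (hN m (by omega)).trans_le Ideal.mul_le_left)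
  have hiffG : ∀ j ≤ k + 1, (j : ℕ∞) ≤ idealDepth (reesMaxIdeal K) (mixedGraded I₁ I₂) ↔
      ∀ i < j, IsStrictFrom F.N (initialIdeal y i) (y i) 0 := fun j hj => by
    rw [hdepthG]
    exact le_idealDepth_quotientGraded_iff hmK hfin hyK h0 hy1 hne1 hs hj
  simp only [isMixedHilbertCoeff_iff hm₁ hm₂ y]
  refine ⟨hex, S, T, colength I₁, hS, hT, (coe_colength hm₁).symm, fun g hg => ?_⟩
  have h := hST g hg
  rw [hF1, ← hiffG (k + 1) le_rfl, ← hiffG k k.le_succ] at h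
  rw [isCohenMacaulayWrt_iff_le hdimG hleG, Nat.add_sub_cancel]
  exact h
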